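/- Proposition 9 (symmetries and master symmetries form a Lie subalgebra). Setting. Let $\gamma_0:\mathbb R\to\mathbb R^3$ be a smooth arclength-parametrized curve whose two ends are asymptotic to one oriented line, i.e. for some $p,v\in\mathbb R^3$, $|v|=1$, and $a,b\in\mathbb R$, $\gamma_0(s)-(p+(s+a)v)\to0$ as $s\to+\infty$ and $\gamma_0(s)-(p+(s+b)v)\to0$ as $s\to-\infty$. Let $BAL$ be the set of smooth arclength-parametrized curves $\gamma:\mathbb R\to\mathbb R^3$ with nowhere vanishing curvature $\kappa$ (and torsion $\tau$, Frenet frame $T,N,B$) such that there are numbers $\ell_+=\ell_-$ with $\gamma(s\pm\ell_\pm)-\gamma_0(s)\to0$ as $s\to\pm\infty$, $\kappa$ is rapidly decreasing ($\kappa P\to0$ at $\pm\infty$ for every polynomial $P$), and all $\kappa^{-1}\partial_s^n\kappa$ and $\partial_s^n\tau$ ($n\ge0$) are asymptotically polynomial-like ($f/P\to0$ at $\pm\infty$ for some polynomial $P\neq0$). Put $\ell=\ell_++\ell_-$. A scalar field is a function of $(\gamma,s)\in BAL\times\mathbb R$, and $$\partial_s^{-1}f(s)=\tfrac12\Bigl(\int_{-\infty}^s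 f-\int_s^\infty f\Bigr),\qquad \int f=\int_{-\infty}^{\infty}f .$$ Let $\mathcal A_n$ ($n\in\mathbb Z$) be the smallest family of real vector spaces of scalar fields with $\kappa\in\mathcal A_1$, $\kappa^{-1}\in\mathcal A_{-1}$, $\tau,s,\ell,1\in\mathcal A_0$, $\mathcal A_n\subset\mathcal A_{n-1}$, $\mathcal A_i\mathcal A_j\subset\mathcal A_{i+j}$, $\partial_s\mathcal A_n\subset\mathcal A_n$, and $\partial_s^{-1}f,\int f\in\mathcal A_0$ for $f\in\mathcal A_2$. A vector field on $BAL$ is an expression $gN+hB$ with $g,h\in\mathcal A_1$, regarded modulo multiples of $T$; $\mathcal X$ is the space of vector fields. Let $\varphi(fT+gN+hB)=gN+hB$, $\wp(gN+hB)=\partial_s^{-1}(\kappa g)T+gN+hB$, $J(gN+hB)=hN-gB$, and let $R=J\circ\varphi\circ\nabla_s\circ\wp$ be the recursion operator, where $\nabla_s$ is differentiation of tangent fields in $s$. For vector fields $X,Y$ let $[X,Y]=\varphi(\Delta_{\wp X}\wp Y)-\varphi(\Delta_{\wp Y}\wp X)$, where $\Delta_V W$ is the variational derivative: along every variation $\Gamma_\varepsilon\in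 BAL$ of $\gamma=\Gamma_0$ with velocity $\partial_\varepsilon\Gamma_\varepsilon|_{\varepsilon=0}=V(\gamma)$, one has $\frac{d}{d\varepsilon}W(\Gamma_\varepsilon,s)|_{\varepsilon=0}=(\Delta_VW)(\gamma,s)$. Here a variation is a family smooth in $(\varepsilon,s)$ such that, for some $\delta>0$ and with $\kappa=\kappa(\Gamma_\varepsilon)$ and $\tau=\tau(\Gamma_\varepsilon)$, $\kappa P$ is bounded on $\{|\varepsilon|<\delta,\ s\in\mathbb R\}$ for every polynomial $P$, and for every $n$ the functions $\kappa^{-1}\partial_s^n\kappa$, $\partial_s^n\tau$, $\kappa^{-1}\partial_\varepsilon\partial_s^n\kappa$, $\partial_\varepsilon\partial_s^n\tau$ are bounded in absolute value by a polynomial in $s$, uniformly in $|\varepsilon|<\delta$. Statement. Put $X_n=R^n(\kappa B)$ for $n\ge0$ and $Y_n=R^{n-1}(s\kappa B)$ for $n\ge1$. Then all $X_n$ and $Y_n$ belong to $\mathcal X$; their real span is contained in $\mathcal X$ and closed under the bracket, so that they form a Lie subalgebra of $\mathcal X$; and $$[X_n,X_m]=0\ (n,m\ge0),\qquad [X_n,Y_m]=(n+2)X_{n+m}\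 (n\ge0,\ m\ge1),\qquad [Y_n,Y_m]=(n-m)Y_{n+m}\ (n,m\ge1).$$ Moreover $\wp(X_0)=\kappa B$ is the flow of the vortex filament equation $\dot\gamma=\kappa B$; hence the $X_n$ are commuting symmetries of it (vector fields that commute with $X_0$), and the $Y_n$ are master symmetries of it (vector fields whose bracket with $X_0$ is a symmetry, namely $[X_0,Y_n]=2X_n$). -/

import Mathlib

open Filter Topology MeasureTheory
open scoped ContDiff

noncomputable section

namespace VortexFilament

/-! ## Curves in Euclidean 3-space and their Frenet apparatus -/

/-- Euclidean three-dimensional space. -/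
abbrev E3 : Type := EuclideanSpace ℝ (Fin 3)

/-- The vector product of `E3`. -/
def cross (u v : E3) : E3 :=
  WithLp.toLp 2 (crossProduct (WithLp.ofLp u) (WithLp.ofLp v))

/-- The tangent vector `T` of a curve parametrized by arclength. -/
def tangentVec (γ : ℝ → E3) (s : ℝ) : E3 := deriv γ s

/-- The curvature `κ` of a curve parametrized by arclength. -/
def curvature (γ : ℝ → E3) (s : ℝ) : ℝ := ‖deriv (tangentVec γ) s‖

/-- The principal normal `N`, so that `T' = κ N`. -/
def normalVec (γ : ℝ → E3) (s : ℝ) : E3 := (curvature γ s)⁻¹ • deriv (tangentVec γ) s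

/-- The binormal `B = T × N`. -/
def binormalVec (γ : ℝ → E3) (s : ℝ) : E3 := cross (tangentVec γ s) (normalVec γ s)

/-- The torsion `τ`, the `B`-component of `N' = -κ T + τ B`. -/
def torsion (γ : ℝ → E3) (s : ℝ) : ℝ := inner ℝ (deriv (normalVec γ) s) (binormalVec γ s)

/-- Smooth curves, infinitely extended and parametrized by arclength. -/
def IsAPC (γ : ℝ → E3) : Prop := ContDiff ℝ ∞ γ ∧ ∀ s, ‖deriv γ s‖ = 1

/-! ## Asymptotic conditions -/

/-- `f / P → 0` as `s → ±∞` for some nonzero real polynomial `P`. -/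
def AsympPolynomialLike (f : ℝ → ℝ) : Prop :=
  ∃ P : Polynomial ℝ, P ≠ 0 ∧ Tendsto (fun s => f s / P.eval s) (atBot ⊔ atTop) (𝓝 0)

/-- `f P → 0` as `s → ±∞` for every real polynomial `P`. -/
def RapidlyDecreasing (f : ℝ → ℝ) : Prop :=
  ∀ P : Polynomial ℝ, Tendsto (fun s => f s * P.eval s) (atBot ⊔ atTop) (𝓝 0)

/-- A reference curve: parametrized by arclength, with both ends asymptotic to one and the same
oriented line `{p + t v}`. -/
def IsReferenceCurve (γ₀ : ℝ → E3) : Prop :=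
  IsAPC γ₀ ∧ ∃ (p v : E3) (a b : ℝ), ‖v‖ = 1 ∧
    Tendsto (fun s => γ₀ s - (p + (s + a) • v)) atTop (𝓝 0) ∧
    Tendsto (fun s => γ₀ s - (p + (s + b) • v)) atBot (𝓝 0)

/-- `γ (s ± ℓ±) → γ₀ s` as `s → ±∞`, with `ℓ₊ = l.1` and `ℓ₋ = l.2`. -/
def HasEndLengths (γ₀ γ : ℝ → E3) (l : ℝ × ℝ) : Prop :=
  Tendsto (fun s => γ (s + l.1) - γ₀ s) atTop (𝓝 0) ∧
  Tendsto (fun s => γ (s - l.2) - γ₀ s) atBot (𝓝 0)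

/-- Balanced asymptotically linear curves, relative to the reference curve `γ₀`. -/
structure IsBAL (γ₀ γ : ℝ → E3) : Prop where
  apc : IsAPC γ
  curvature_ne_zero : ∀ s, curvature γ s ≠ 0
  balanced : ∃ l : ℝ × ℝ, HasEndLengths γ₀ γ l ∧ l.1 = l.2
  curvature_decay : RapidlyDecreasing (curvature γ)
  curvature_deriv : ∀ n : ℕ,
    AsympPolynomialLike fun s => (curvature γ s)⁻¹ * iteratedDeriv n (curvature γ) s
  torsion_deriv : ∀ n : ℕ, AsympPolynomialLike (iteratedDeriv n (torsion γ))

/-- The space of balanced asymptotically linear curves. -/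
def BAL (γ₀ : ℝ → E3) : Type := {γ : ℝ → E3 // IsBAL γ₀ γ}

/-! ## Scalar fields and tangent fields -/

/-- Scalar fields: real functions of a curve `γ` of `BAL` and of the parameter `s`. -/
abbrev ScalarField (γ₀ : ℝ → E3) : Type := BAL γ₀ → ℝ → ℝ

/-- Tangent fields: the vector at `(γ, s)` lies in the tangent space of `E3` at `γ s`, that is,
in `E3`. -/
abbrev TangentField (γ₀ : ℝ → E3) : Type := BAL γ₀ → ℝ → E3

section Fields

variable {γ₀ : ℝ → E3}

/-- The scalar field `κ`. -/
def kappa : ScalarField γ₀ := fun γ s => curvature γ.1 s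

/-- The scalar field `τ`. -/
def tau : ScalarField γ₀ := fun γ s => torsion γ.1 s

/-- The scalar field `s`. -/
def param : ScalarField γ₀ := fun _ s => s

/-- The renormalized length `ℓ = ℓ₊ + ℓ₋`. (The numbers `ℓ±` are unique, since the reference
curve is asymptotic to a line.) -/
def renLength : ScalarField γ₀ := fun γ _ =>
  (Classical.choose γ.2.balanced).1 + (Classical.choose γ.2.balanced).2

/-- The tangent field `T`. -/
def fieldT : TangentField γ₀ := fun γ s => tangentVec γ.1 s

/-- The tangent field `N`. -/
def fieldN : TangentField γ₀ := fun γ s => normalVec γ.1 s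

/-- The tangent field `B`. -/
def fieldB : TangentField γ₀ := fun γ s => binormalVec γ.1 s

/-- The derivative `∂ₛ` of a scalar field. -/
def dS (f : ScalarField γ₀) : ScalarField γ₀ := fun γ s => deriv (f γ) s

/-- The derivative `∇ₛ` of a tangent field. -/
def nablaS (V : TangentField γ₀) : TangentField γ₀ := fun γ s => deriv (V γ) s

/-- The antiderivative `∂ₛ⁻¹` of a scalar field. -/
def antiS (f : ScalarField γ₀) : ScalarField γ₀ := fun γ s =>
  (1 / 2) * ((∫ t in Set.Iic s, f γ t) - ∫ t in Set.Ioi s, f γ t)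

/-- The definite integral of a scalar field. -/
def intS (f : ScalarField γ₀) : ScalarField γ₀ := fun γ _ => ∫ t, f γ t

/-- `Alg n f` : the scalar field `f` has an expression of degree `n`, built from
`κ, κ⁻¹, τ, s, ℓ, 1` by sums, real multiples, products, `∂ₛ`, `∂ₛ⁻¹` and `∫`, where `∂ₛ⁻¹` and `∫`
are applied to expressions of degree `2` only and give expressions of degree `0`. -/
inductive Alg : ℤ → ScalarField γ₀ → Prop
  | kappa : Alg 1 kappa
  | kappaInv : Alg (-1) (fun γ s => (kappa γ s)⁻¹)
  | tau : Alg 0 tau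
  | param : Alg 0 param
  | renLength : Alg 0 renLength
  | one : Alg 0 1
  | add {n : ℤ} {f g : ScalarField γ₀} : Alg n f → Alg n g → Alg n (f + g)
  | smul {n : ℤ} (c : ℝ) {f : ScalarField γ₀} : Alg n f → Alg n (c • f)
  | lower {n : ℤ} {f : ScalarField γ₀} : Alg n f → Alg (n - 1) f
  | mul {i j : ℤ} {f g : ScalarField γ₀} : Alg i f → Alg j g → Alg (i + j) (f * g)
  | dS {n : ℤ} {f : ScalarField γ₀} : Alg n f → Alg n (dS f)
  | antiS {f : ScalarField γ₀} : Alg 2 f → Alg 0 (antiS f)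
  | intS {f : ScalarField γ₀} : Alg 2 f → Alg 0 (intS f)

/-! ## Vector fields on the space of curves -/

variable (γ₀) in
/-- Fields `g N + h B` (tangent fields modulo multiples of `T`), as pairs `(g, h)` of
coefficients. -/
abbrev NormalField : Type := ScalarField γ₀ × ScalarField γ₀

variable (γ₀) in
/-- The vector fields on `BAL`: the fields `g N + h B` with `g` and `h` of degree `1`. -/
def vectorFields : Submodule ℝ (NormalField γ₀) where
  carrier := {X | Alg 1 X.1 ∧ Alg 1 X.2}
  add_mem' hX hY := ⟨hX.1.add hY.1, hX.2.add hY.2⟩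
  zero_mem' := by
    have h : Alg (γ₀ := γ₀) 1 0 := by
      have h1 := Alg.smul (0 : ℝ) (Alg.kappa (γ₀ := γ₀))
      rwa [zero_smul] at h1
    exact ⟨h, h⟩
  smul_mem' c _ hX := ⟨hX.1.smul c, hX.2.smul c⟩

/-- The projection `φ (f T + g N + h B) = g N + h B`. -/
def proj (V : TangentField γ₀) : NormalField γ₀ :=
  (fun γ s => inner ℝ (fieldN γ s) (V γ s), fun γ s => inner ℝ (fieldB γ s) (V γ s))

/-- The injection `℘ (g N + h B) = ∂ₛ⁻¹ (κ g) T + g N + h B`. -/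
def lift (X : NormalField γ₀) : TangentField γ₀ := fun γ s =>
  antiS (kappa * X.1) γ s • fieldT γ s + X.1 γ s • fieldN γ s + X.2 γ s • fieldB γ s

/-- The complex structure `J (g N + h B) = h N - g B`. -/
def opJ (X : NormalField γ₀) : NormalField γ₀ := (X.2, -X.1)

/-- The recursion operator `R = J ∘ φ ∘ ∇ₛ ∘ ℘`. -/
def recOp (X : NormalField γ₀) : NormalField γ₀ := opJ (proj (nablaS (lift X)))

variable (γ₀) in
/-- The vector fields `X_n = R^n (κ B)`. -/
def symX (n : ℕ) : NormalField γ₀ := recOp^[n] (0, kappa)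

variable (γ₀) in
/-- The vector fields `Y_n = R^(n-1) (s κ B)`, meant for `n ≥ 1`. -/
def masterY (n : ℕ) : NormalField γ₀ := recOp^[n - 1] (0, param * kappa)

/-! ## Variational differentiation and the commutator product -/

/-- `Γ` is a smooth variation of `γ` within `BAL` whose velocity at `γ` is the tangent field `V`;
the asymptotic conditions on the curves `Γ ε`, and on the first `ε`-derivatives, hold uniformly
in `ε` near `0`. -/
structure IsVariation (V : TangentField γ₀) (γ : BAL γ₀) (Γ : ℝ → BAL γ₀) : Prop where
  base : Γ 0 = γ
  smooth : ContDiff ℝ ∞ fun q : ℝ × ℝ => (Γ q.1).1 q.2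
  velocity : ∀ s, HasDerivAt (fun ε => (Γ ε).1 s) (V γ s) 0
  uniform : ∃ δ > 0,
    (∀ P : Polynomial ℝ, ∃ C : ℝ, ∀ ε, |ε| < δ → ∀ s, |kappa (Γ ε) s * P.eval s| ≤ C) ∧
    ∀ n : ℕ, ∃ P : Polynomial ℝ, ∀ ε, |ε| < δ → ∀ s,
      |(kappa (Γ ε) s)⁻¹ * iteratedDeriv n (kappa (Γ ε)) s| ≤ P.eval s ∧
      |iteratedDeriv n (tau (Γ ε)) s| ≤ P.eval s ∧
      |(kappa (Γ ε) s)⁻¹ * deriv (fun e => iteratedDeriv n (kappa (Γ e)) s) ε| ≤ P.eval s ∧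
      |deriv (fun e => iteratedDeriv n (tau (Γ e)) s) ε| ≤ P.eval s

/-- `W'` is the variational derivative of the tangent field `W` in the direction of `V`: along
every variation with velocity `V`, the field `W` is differentiable with derivative `W'`. -/
def HasVariation (V W W' : TangentField γ₀) : Prop :=
  ∀ (γ : BAL γ₀) (Γ : ℝ → BAL γ₀), IsVariation V γ Γ →
    ∀ s, HasDerivAt (fun ε => W (Γ ε) s) (W' γ s) 0

/-- `Z = [X, Y]`, the difference of `φ` of the variational derivative of `℘ Y` in the direction
`℘ X` and of `φ` of the variational derivative of `℘ X` in the direction `℘ Y`. -/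
def IsCommutator (X Y Z : NormalField γ₀) : Prop :=
  ∃ A B : TangentField γ₀, HasVariation (lift X) (lift Y) A ∧ HasVariation (lift Y) (lift X) B ∧
    Z = proj A - proj B

/-- `X` is a symmetry of the evolution equation with flow `F`: a vector field that commutes
with `F`. -/
def IsSymmetry (F X : NormalField γ₀) : Prop := X ∈ vectorFields γ₀ ∧ IsCommutator F X 0

/-- `M` is a master symmetry of the evolution equation with flow `F`: a vector field whose
commutator with `F` is a symmetry. -/
def IsMasterSymmetry (F M : NormalField γ₀) : Prop :=
  M ∈ vectorFields γ₀ ∧ ∃ W, IsCommutator F M W ∧ IsSymmetry F W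

variable (γ₀) in
/-- The real span of the vector fields `X_n`, `n ≥ 0`, and `Y_n`, `n ≥ 1`. -/
def symSpan : Submodule ℝ (NormalField γ₀) :=
  Submodule.span ℝ (Set.range (symX γ₀) ∪ masterY γ₀ '' {n | 1 ≤ n})

end Fields

end VortexFilament

end

open VortexFilament

noncomputable section

namespace VortexFilament

open scoped SchwartzMap

/-! ## The vector product -/

/-! The recursion becomes simple on tangent fields. For V = ℘X, `lift_recOp` shows that W = ℘(RX) is
the solution of V' = T × W with ⟨T, W'⟩ = 0 and balanced tangential part (`nextField`). It is unique
by `Balanced.eq_zero`: a solution of the homogeneous problem is cT with c constant, while balance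
makes the limits of c at the two ends opposite, so c = 0. Identities between balanced
arclength-preserving fields may therefore be checked after taking the product with T.

The fields κB and sκB are successors too, namely of -T and of γ - sT, the generators of parameter
shifts and of scalings. Let V_0 = b(γ - sT) - cT and let V_n be its n-th successor (`chain`); then
V_{n+1} is ℘ of the n-th member of the hierarchy (`lift_hierarchy`).

Varying V' = T × RV and using the Jacobi identity of the vector product gives two rules for the Lie
derivative L_A R of the recursion: R[A, V] = [A, RV] - (L_A R)V (`hasDerivAt_bracket`) and L_{RA} R
= R ∘ L_A R (`cross_lieRec`, heredity of R). Along V_0 the Lie derivative is -bR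
(`cross_lieRec_zero`), hence it is -bR^{i+1} along V_i (`lieRec_chain`), and [V_i, RV] = R[V_i, V] -
bR^{i+1}V (`bracket_chain_succ`). All commutators follow by induction from [X_0, X_0] = 0, [Y_1,
Y_1] = 0 and the computation [X_0, Y_1] = 2X_1 (`bracket_one_one`).

The variations in this calculus are formal. That they are the true derivatives along variations of
curves (`hasDerivAt_lift_hierarchy`) requires differentiation under ∂ₛ⁻¹ and exchange of ∂_ε with
∂ₛ. Both come from the class `Tame`, which is closed under the recursion and carries bounds uniform
in ε (`Tame.controlled_and_deriv`). Along a fixed curve, κ is a Schwartz function while τ and the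
frame have temperate growth.

Finally, true variations test a variational derivative only in directions that they realize.
Linearity is therefore kept on pairs of a field and a variation operator (`varFields`), and closure
of the span is bilinear extension from the generators. -/

lemma cross_apply_zero (u v : E3) : cross u v 0 = u 1 * v 2 - u 2 * v 1 := by
  simp [cross, _root_.cross_apply]
lemma cross_apply_one (u v : E3) : cross u v 1 = u 2 * v 0 - u 0 * v 2 := by
  simp [cross, _root_.cross_apply]
lemma cross_apply_two (u v : E3) : cross u v 2 = u 0 * v 1 - u 1 * v 0 := by
  simp [cross, _root_.cross_apply]

lemma inner_eq_sum (u v : E3) : inner ℝ u v = u 0 * v 0 + u 1 * v 1 + u 2 * v 2 := by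
  simp [PiLp.inner_apply, Fin.sum_univ_three, mul_comm]

lemma E3_ext {u v : E3} (h0 : u 0 = v 0) (h1 : u 1 = v 1) (h2 : u 2 = v 2) : u = v := by
  ext i; fin_cases i <;> assumption

/-- The vector product as a continuous bilinear map. -/
def crossCLM : E3 →L[ℝ] E3 →L[ℝ] E3 :=
  LinearMap.toContinuousLinearMap
    ((LinearMap.toContinuousLinearMap (𝕜 := ℝ) (E := E3) (F' := E3)).toLinearMap ∘ₗ
      LinearMap.mk₂ ℝ cross
        (by intro u v w; apply E3_ext <;>
              simp [cross_apply_zero, cross_apply_one, cross_apply_two] <;> ring)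
        (by intro c u v; apply E3_ext <;>
              simp [cross_apply_zero, cross_apply_one, cross_apply_two] <;> ring)
        (by intro u v w; apply E3_ext <;>
              simp [cross_apply_zero, cross_apply_one, cross_apply_two] <;> ring)
        (by intro c u v; apply E3_ext <;>
              simp [cross_apply_zero, cross_apply_one, cross_apply_two] <;> ring))

@[simp] lemma crossCLM_apply (u v : E3) : crossCLM u v = cross u v := rfl

lemma cross_add (u v w : E3) : cross u (v + w) = cross u v + cross u w := (crossCLM u).map_add v w
lemma cross_sub (u v w : E3) : cross u (v - w) = cross u v - cross u w := (crossCLM u).map_sub v w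
lemma cross_neg (u v : E3) : cross u (-v) = -cross u v := (crossCLM u).map_neg v
lemma cross_smul (c : ℝ) (u v : E3) : cross u (c • v) = c • cross u v := (crossCLM u).map_smul c v
lemma cross_zero (u : E3) : cross u 0 = 0 := (crossCLM u).map_zero
lemma add_cross (u v w : E3) : cross (u + v) w = cross u w + cross v w := crossCLM.map_add₂ u v w
lemma neg_cross (u v : E3) : cross (-u) v = -cross u v := crossCLM.map_neg₂ u v
lemma smul_cross (c : ℝ) (u v : E3) : cross (c • u) v = c • cross u v := crossCLM.map_smul₂ c u v

lemma cross_self (u : E3) : cross u u = 0 := by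
  apply E3_ext <;> simp [cross_apply_zero, cross_apply_one, cross_apply_two] <;> ring

lemma cross_anticomm (u v : E3) : cross u v = -cross v u := by
  apply E3_ext <;> simp [cross_apply_zero, cross_apply_one, cross_apply_two] <;> ring

lemma cross_leibniz (u v w : E3) :
    cross u (cross v w) = cross (cross u v) w + cross v (cross u w) := by
  apply E3_ext <;> simp [cross_apply_zero, cross_apply_one, cross_apply_two] <;> ring

lemma cross_cross (u v w : E3) :
    cross u (cross v w) = (inner ℝ u w : ℝ) • v - (inner ℝ u v : ℝ) • w := by
  apply E3_ext <;>
    simp [cross_apply_zero, cross_apply_one, cross_apply_two, inner_eq_sum] <;> ring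

lemma inner_cross_perm (u v w : E3) : inner ℝ u (cross v w) = inner ℝ v (cross w u) := by
  simp only [inner_eq_sum, cross_apply_zero, cross_apply_one, cross_apply_two]; ring

lemma inner_cross_swap (u v w : E3) : inner ℝ u (cross v w) = -inner ℝ v (cross u w) := by
  simp only [inner_eq_sum, cross_apply_zero, cross_apply_one, cross_apply_two]; ring

lemma inner_self_cross (u v : E3) : inner ℝ u (cross u v) = 0 := by
  simp only [inner_eq_sum, cross_apply_zero, cross_apply_one, cross_apply_two]; ring

lemma inner_cross_self (u v : E3) : inner ℝ v (cross u v) = 0 := by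
  simp only [inner_eq_sum, cross_apply_zero, cross_apply_one, cross_apply_two]; ring

lemma inner_self_of_norm_eq_one {u : E3} (h : ‖u‖ = 1) : inner ℝ u u = 1 := by
  rw [real_inner_self_eq_norm_sq, h]; norm_num

/-- A vector whose product with a unit vector vanishes is a multiple of the latter. -/
lemma eq_smul_of_cross_eq_zero {u w : E3} (hu : ‖u‖ = 1) (h : cross u w = 0) :
    w = (inner ℝ u w : ℝ) • u := by
  have := cross_cross u u w
  rw [h, cross_zero, inner_self_of_norm_eq_one hu, one_smul] at this
  exact (sub_eq_zero.mp this.symm).symm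

lemma hasDerivAt_cross {f g : ℝ → E3} {f' g' : E3} {s : ℝ} (hf : HasDerivAt f f' s)
    (hg : HasDerivAt g g' s) :
    HasDerivAt (fun t => cross (f t) (g t)) (cross f' (g s) + cross (f s) g') s := by
  have := (crossCLM.hasFDerivAt_of_bilinear hf.hasFDerivAt hg.hasFDerivAt).hasDerivAt
  simpa [add_comm] using this

/-! ## Schwartz functions and functions of temperate growth -/

section Growth

variable {E F G : Type*} [NormedAddCommGroup E] [NormedSpace ℝ E]
  [NormedAddCommGroup F] [NormedSpace ℝ F] [NormedAddCommGroup G] [NormedSpace ℝ G]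

/-- `f` is a Schwartz function. -/
def IsSch (f : ℝ → E) : Prop := ∃ φ : 𝓢(ℝ, E), ⇑φ = f

lemma IsSch.add {f g : ℝ → E} (hf : IsSch f) (hg : IsSch g) : IsSch (fun s => f s + g s) := by
  obtain ⟨φ, rfl⟩ := hf
  obtain ⟨ψ, rfl⟩ := hg
  exact ⟨φ + ψ, rfl⟩

lemma IsSch.neg {f : ℝ → E} (hf : IsSch f) : IsSch (fun s => -f s) := by
  obtain ⟨φ, rfl⟩ := hf
  exact ⟨-φ, rfl⟩

lemma IsSch.sub {f g : ℝ → E} (hf : IsSch f) (hg : IsSch g) : IsSch (fun s => f s - g s) := by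
  obtain ⟨φ, rfl⟩ := hf
  obtain ⟨ψ, rfl⟩ := hg
  exact ⟨φ - ψ, rfl⟩

lemma IsSch.const_smul {f : ℝ → E} (c : ℝ) (hf : IsSch f) : IsSch (fun s => c • f s) := by
  obtain ⟨φ, rfl⟩ := hf
  exact ⟨c • φ, rfl⟩

lemma IsSch.zero : IsSch (fun _ : ℝ => (0 : E)) := ⟨0, rfl⟩

lemma IsSch.contDiff {f : ℝ → E} (hf : IsSch f) : ContDiff ℝ ∞ f := by
  obtain ⟨φ, rfl⟩ := hf
  exact φ.smooth ⊤

lemma IsSch.continuous {f : ℝ → E} (hf : IsSch f) : Continuous f := hf.contDiff.continuous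

lemma IsSch.differentiable {f : ℝ → E} (hf : IsSch f) : Differentiable ℝ f :=
  hf.contDiff.differentiable (by simp)

lemma IsSch.deriv {f : ℝ → E} (hf : IsSch f) : IsSch (deriv f) := by
  obtain ⟨φ, rfl⟩ := hf
  exact ⟨SchwartzMap.derivCLM ℝ E φ, by ext s; simp⟩

lemma IsSch.integrable {f : ℝ → ℝ} (hf : IsSch f) : Integrable f := by
  obtain ⟨φ, rfl⟩ := hf
  exact φ.integrable

lemma IsSch.hasTemperateGrowth {f : ℝ → E} (hf : IsSch f) : f.HasTemperateGrowth := by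
  obtain ⟨φ, rfl⟩ := hf
  exact φ.hasTemperateGrowth

lemma IsSch.tendsto_cocompact {f : ℝ → E} (hf : IsSch f) : Tendsto f (cocompact ℝ) (𝓝 0) := by
  obtain ⟨φ, rfl⟩ := hf
  exact φ.tendsto_cocompact

lemma IsSch.bilin {f : ℝ → E} {g : ℝ → F} (B : E →L[ℝ] F →L[ℝ] G) (hf : IsSch f)
    (hg : g.HasTemperateGrowth) : IsSch (fun s => B (f s) (g s)) := by
  obtain ⟨φ, rfl⟩ := hf
  exact ⟨SchwartzMap.bilinLeftCLM B hg φ, by ext s; simp⟩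

lemma IsSch.smul_temperate {f : ℝ → ℝ} {g : ℝ → E} (hf : IsSch f) (hg : g.HasTemperateGrowth) :
    IsSch (fun s => f s • g s) := hf.bilin (ContinuousLinearMap.lsmul ℝ ℝ) hg

lemma IsSch.temperate_smul {f : ℝ → ℝ} {g : ℝ → E} (hg : IsSch g) (hf : f.HasTemperateGrowth) :
    IsSch (fun s => f s • g s) := hg.bilin (ContinuousLinearMap.lsmul ℝ ℝ).flip hf

lemma IsSch.cross_temperate {f g : ℝ → E3} (hf : IsSch f) (hg : g.HasTemperateGrowth) :
    IsSch (fun s => cross (f s) (g s)) := hf.bilin crossCLM hg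

lemma IsSch.temperate_cross {f g : ℝ → E3} (hg : IsSch g) (hf : f.HasTemperateGrowth) :
    IsSch (fun s => cross (f s) (g s)) := hg.bilin crossCLM.flip hf

lemma IsSch.inner_temperate {f g : ℝ → E3} (hf : IsSch f) (hg : g.HasTemperateGrowth) :
    IsSch (fun s => (inner ℝ (f s) (g s) : ℝ)) := hf.bilin (innerSL ℝ) hg

lemma IsSch.temperate_inner {f g : ℝ → E3} (hg : IsSch g) (hf : f.HasTemperateGrowth) :
    IsSch (fun s => (inner ℝ (f s) (g s) : ℝ)) := by
  simpa only [real_inner_comm] using hg.inner_temperate hf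

/-- Only the bound of order zero is needed for `f` itself, since the higher derivatives are those of
`f'`. This serves for `antiD q`, which is bounded but need not decay. -/
lemma temperate_of_deriv {f f' : ℝ → E} (h : ∀ s, HasDerivAt f (f' s) s)
    (hf' : f'.HasTemperateGrowth) {k : ℕ} {C : ℝ} (hb : ∀ s, ‖f s‖ ≤ C * (1 + ‖s‖) ^ k) :
    f.HasTemperateGrowth := by
  have hfd : fderiv ℝ f = fun s => ContinuousLinearMap.smulRightL ℝ ℝ E
      (ContinuousLinearMap.id ℝ ℝ) (f' s) := by
    ext s
    simp [(h s).hasFDerivAt.fderiv]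
  refine Function.HasTemperateGrowth.of_fderiv ?_ (fun s => (h s).differentiableAt) hb
  rw [hfd]
  exact (ContinuousLinearMap.hasTemperateGrowth _).comp hf'

lemma temperate_deriv {f : ℝ → E} (hf : f.HasTemperateGrowth) :
    (deriv f).HasTemperateGrowth := by
  refine ⟨?_, fun n => ?_⟩
  · exact (contDiff_infty_iff_deriv.mp hf.1).2
  · obtain ⟨k, C, h⟩ := hf.2 (n + 1)
    refine ⟨k, C, fun s => ?_⟩
    have := h s
    rwa [norm_iteratedFDeriv_eq_norm_iteratedDeriv, iteratedDeriv_succ',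
      ← norm_iteratedFDeriv_eq_norm_iteratedDeriv] at this

end Growth

/-! ## The balanced antiderivative -/

/-- The antiderivative of `q` with opposite limits at both ends. -/
def antiD (q : ℝ → ℝ) (s : ℝ) : ℝ :=
  (1 / 2) * ((∫ t in Set.Iic s, q t) - ∫ t in Set.Ioi s, q t)

lemma antiD_eq {q : ℝ → ℝ} (hq : Integrable q) (s : ℝ) :
    antiD q s = (∫ t in Set.Iic s, q t) - (1 / 2) * ∫ t, q t := by
  have := intervalIntegral.integral_Iic_add_Ioi (μ := volume) (b := s) hq.integrableOn hq.integrableOn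
  rw [antiD, ← this]; ring

lemma hasDerivAt_antiD {q : ℝ → ℝ} (hq : Integrable q) (hc : Continuous q) (s : ℝ) :
    HasDerivAt (antiD q) (q s) s := by
  have h : antiD q = fun s => (∫ t in (0 : ℝ)..s, q t) + ((∫ t in Set.Iic 0, q t)
      - (1 / 2) * ∫ t, q t) := by
    ext s
    rw [antiD_eq hq, ← intervalIntegral.integral_Iic_sub_Iic hq.integrableOn hq.integrableOn]
    ring
  rw [h]
  exact (intervalIntegral.integral_hasDerivAt_right (hc.intervalIntegrable _ _)
    (hc.stronglyMeasurableAtFilter _ _) hc.continuousAt).add_const _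

lemma abs_antiD_le (q : ℝ → ℝ) (hq : Integrable q) (s : ℝ) : |antiD q s| ≤ ∫ t, |q t| := by
  have h1 : |∫ t in Set.Iic s, q t| ≤ ∫ t, |q t| :=
    (abs_integral_le_integral_abs).trans
      (setIntegral_le_integral hq.abs (ae_of_all _ fun _ => abs_nonneg _))
  have h2 : |∫ t in Set.Ioi s, q t| ≤ ∫ t, |q t| :=
    (abs_integral_le_integral_abs).trans
      (setIntegral_le_integral hq.abs (ae_of_all _ fun _ => abs_nonneg _))
  rw [antiD, abs_le]
  constructor <;> linarith [abs_le.mp h1, abs_le.mp h2, (abs_le.mp h1).1, (abs_le.mp h1).2,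
    (abs_le.mp h2).1, (abs_le.mp h2).2]

lemma antiD_add {p q : ℝ → ℝ} (hp : Integrable p) (hq : Integrable q) (s : ℝ) :
    antiD (fun t => p t + q t) s = antiD p s + antiD q s := by
  simp only [antiD]
  rw [integral_add hp.integrableOn hq.integrableOn, integral_add hp.integrableOn hq.integrableOn]
  ring

lemma antiD_const_mul (c : ℝ) (q : ℝ → ℝ) (s : ℝ) :
    antiD (fun t => c * q t) s = c * antiD q s := by
  simp only [antiD, integral_const_mul]; ring

lemma antiD_zero (s : ℝ) : antiD (fun _ => 0) s = 0 := by simp [antiD]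

/-- The limits at the two ends are ±½∫q. This normalization, which excludes nonzero constants, is
the source of uniqueness in the recursion. -/
lemma tendsto_antiD_add_neg {q : ℝ → ℝ} (hq : Integrable q) :
    Tendsto (fun s => antiD q s + antiD q (-s)) atTop (𝓝 0) := by
  have h1 : Tendsto (fun s => ∫ t in Set.Iic (-s), q t) atTop (𝓝 0) :=
    (tendsto_integral_Iic_zero (f := q) tendsto_id).comp tendsto_neg_atTop_atBot
  have h2 : Tendsto (fun s => ∫ t in Set.Ioi s, q t) atTop (𝓝 0) :=
    tendsto_integral_Ioi_zero (f := q) tendsto_id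
  have : (fun s => antiD q s + antiD q (-s)) =
      fun s => (∫ t in Set.Iic (-s), q t) - ∫ t in Set.Ioi s, q t := by
    ext s
    have := intervalIntegral.integral_Iic_add_Ioi (μ := volume) (b := s) hq.integrableOn hq.integrableOn
    rw [antiD_eq hq, antiD_eq hq, ← this]; ring
  rw [this]
  simpa using h1.sub h2

lemma IsSch.hasDerivAt_antiD {q : ℝ → ℝ} (hq : IsSch q) (s : ℝ) :
    HasDerivAt (antiD q) (q s) s := VortexFilament.hasDerivAt_antiD hq.integrable hq.continuous s

lemma IsSch.temperate_antiD {q : ℝ → ℝ} (hq : IsSch q) : (antiD q).HasTemperateGrowth :=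
  temperate_of_deriv (k := 0) (C := ∫ t, |q t|) hq.hasDerivAt_antiD hq.hasTemperateGrowth
    fun s => by simpa using abs_antiD_le q hq.integrable s

/-! ## Balanced fields along a curve -/

/-- A tangent indicatrix: a unit vector field whose derivative is a Schwartz function. -/
structure IsIndicatrix (T : ℝ → E3) : Prop where
  norm_one : ∀ s, ‖T s‖ = 1
  temperate : T.HasTemperateGrowth
  sch : IsSch (deriv T)

/-- The sum of a Schwartz function and of a multiple of `T` by a balanced antiderivative. -/
def Balanced (T W : ℝ → E3) : Prop :=
  ∃ (n : ℝ → E3) (q : ℝ → ℝ), IsSch n ∧ IsSch q ∧ W = fun s => n s + antiD q s • T s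

section

variable {T : ℝ → E3}

lemma IsIndicatrix.differentiable (hT : IsIndicatrix T) : Differentiable ℝ T :=
  hT.temperate.1.differentiable (by simp)

lemma IsIndicatrix.hasDerivAt (hT : IsIndicatrix T) (s : ℝ) : HasDerivAt T (deriv T s) s :=
  (hT.differentiable s).hasDerivAt

lemma IsIndicatrix.inner_self (hT : IsIndicatrix T) (s : ℝ) : inner ℝ (T s) (T s) = (1 : ℝ) :=
  inner_self_of_norm_eq_one (hT.norm_one s)

lemma IsIndicatrix.inner_deriv (hT : IsIndicatrix T) (s : ℝ) :
    inner ℝ (T s) (deriv T s) = (0 : ℝ) := by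
  have h := (hT.hasDerivAt s).inner ℝ (hT.hasDerivAt s)
  simp only [hT.inner_self] at h
  have h0 := h.unique (hasDerivAt_const s (1 : ℝ))
  rw [real_inner_comm (T s) (deriv T s)] at h0
  linarith

lemma Balanced.hasDerivAt (hT : IsIndicatrix T) {n : ℝ → E3} {q : ℝ → ℝ} (hn : IsSch n)
    (hq : IsSch q) (s : ℝ) :
    HasDerivAt (fun s => n s + antiD q s • T s)
      (deriv n s + (antiD q s • deriv T s + q s • T s)) s :=
  (hn.differentiable s).hasDerivAt.add ((hq.hasDerivAt_antiD s).smul (hT.hasDerivAt s))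

lemma Balanced.differentiable (hT : IsIndicatrix T) {W : ℝ → E3} (hW : Balanced T W) :
    Differentiable ℝ W := by
  obtain ⟨n, q, hn, hq, rfl⟩ := hW
  exact fun s => (Balanced.hasDerivAt hT hn hq s).differentiableAt

lemma Balanced.sch_deriv (hT : IsIndicatrix T) {W : ℝ → E3} (hW : Balanced T W) :
    IsSch (deriv W) := by
  obtain ⟨n, q, hn, hq, rfl⟩ := hW
  rw [show deriv (fun s => n s + antiD q s • T s) = _ from
    funext fun s => (Balanced.hasDerivAt hT hn hq s).deriv]
  exact hn.deriv.add ((hT.sch.temperate_smul hq.temperate_antiD).add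
    (hq.smul_temperate hT.temperate))

lemma IsSch.balanced {n : ℝ → E3} (hn : IsSch n) : Balanced T n :=
  ⟨n, fun _ => 0, hn, IsSch.zero, by ext1 s; simp [antiD_zero]⟩

lemma Balanced.add {W Z : ℝ → E3} (hW : Balanced T W) (hZ : Balanced T Z) :
    Balanced T (W + Z) := by
  obtain ⟨n, q, hn, hq, rfl⟩ := hW
  obtain ⟨m, p, hm, hp, rfl⟩ := hZ
  refine ⟨_, _, hn.add hm, hq.add hp, ?_⟩
  ext1 s
  rw [antiD_add hq.integrable hp.integrable]
  simp only [Pi.add_apply]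
  module

lemma Balanced.smul (c : ℝ) {W : ℝ → E3} (hW : Balanced T W) : Balanced T (c • W) := by
  obtain ⟨n, q, hn, hq, rfl⟩ := hW
  refine ⟨_, _, hn.const_smul c, hq.const_smul c, ?_⟩
  ext1 s
  simp only [smul_eq_mul, antiD_const_mul, Pi.smul_apply]
  module

lemma Balanced.neg {W : ℝ → E3} (hW : Balanced T W) : Balanced T (-W) := by
  simpa using hW.smul (-1)

lemma Balanced.sub {W Z : ℝ → E3} (hW : Balanced T W) (hZ : Balanced T Z) :
    Balanced T (W - Z) := by
  rw [sub_eq_add_neg]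
  exact hW.add hZ.neg

/-- The product of the two tangential parts vanishes and every other term has a Schwartz factor, so
the result is even a Schwartz function. -/
lemma balanced_cross {W Z : ℝ → E3} (hT : IsIndicatrix T) (hW : Balanced T W)
    (hZ : Balanced T Z) : Balanced T (fun s => cross (W s) (Z s)) := by
  obtain ⟨n, q, hn, hq, rfl⟩ := hW
  obtain ⟨m, p, hm, hp, rfl⟩ := hZ
  have h : IsSch fun s => (cross (n s) (m s) +
      antiD p s • cross (n s) (T s)) + antiD q s • cross (T s) (m s) :=
    ((hn.cross_temperate hm.hasTemperateGrowth).add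
      ((hn.cross_temperate hT.temperate).temperate_smul hp.temperate_antiD)).add
      ((hm.temperate_cross hT.temperate).temperate_smul hq.temperate_antiD)
  convert h.balanced (T := T) using 1
  ext1 s
  simp only [add_cross, cross_add, smul_cross, cross_smul, cross_self]
  module

/-- A balanced field that is tangential and locally arclength preserving vanishes. -/
lemma Balanced.eq_zero (hT : IsIndicatrix T) {W : ℝ → E3} (hW : Balanced T W)
    (hperp : ∀ s, inner ℝ (T s) (deriv W s) = (0 : ℝ)) (htan : ∀ s, cross (T s) (W s) = 0) :
    W = 0 := by
  set c : ℝ → ℝ := fun s => inner ℝ (T s) (W s) with hc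
  have hWc : ∀ s, W s = c s • T s := fun s => eq_smul_of_cross_eq_zero (hT.norm_one s) (htan s)
  -- The remaining term ⟨T', W⟩ = c⟨T', T⟩ vanishes because T has constant length.
  have hdc : ∀ s, HasDerivAt c 0 s := by
    intro s
    have h := (hT.hasDerivAt s).inner ℝ (hW.differentiable hT s).hasDerivAt
    rw [hperp, hWc s, inner_smul_right, real_inner_comm, hT.inner_deriv] at h
    simpa using h
  have hconst : ∀ s, c s = c 0 := fun s =>
    is_const_of_deriv_eq_zero (fun s => (hdc s).differentiableAt) (fun s => (hdc s).deriv) s 0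
  obtain ⟨n, q, hn, hq, hWq⟩ := hW
  have hcq : ∀ s, c s = inner ℝ (T s) (n s) + antiD q s := by
    intro s
    simp only [hc, hWq, inner_add_right, inner_smul_right, hT.inner_self, mul_one]
  have hTn := (hn.temperate_inner hT.temperate).tendsto_cocompact
  rw [cocompact_eq_atBot_atTop, tendsto_sup] at hTn
  -- The Schwartz part decays and the balanced antiderivative has opposite limits at the ends; but
  -- this sum is twice the constant c.
  have hlim : Tendsto (fun s => c s + c (-s)) atTop (𝓝 0) := by
    have := (hTn.2.add (hTn.1.comp tendsto_neg_atTop_atBot)).add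
      (tendsto_antiD_add_neg hq.integrable)
    simp only [add_zero] at this
    refine this.congr fun s => ?_
    simp only [hcq, Function.comp]
    ring
  have h0 : c 0 + c 0 = 0 := by
    refine tendsto_nhds_unique (tendsto_const_nhds (f := (atTop : Filter ℝ))) (hlim.congr ?_)
    intro s
    rw [hconst s, hconst (-s)]
  ext1 s
  rw [hWc s, hconst s, show c 0 = 0 by linarith, zero_smul, Pi.zero_apply]

end

/-! ## Jets of fields and the recursion -/

/-- A balanced locally arclength preserving field: the directions of variation of the curve. -/
structure IsDirection (T A : ℝ → E3) : Prop where
  balanced : Balanced T A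
  perp : ∀ s, inner ℝ (T s) (deriv A s) = (0 : ℝ)

/-- A field along a curve, with its variation in each direction. -/
structure Jet where
  /-- The field. -/
  field : ℝ → E3
  /-- Its variation. -/
  var : (ℝ → E3) → ℝ → E3

/-- The density whose antiderivative is the tangential component of the next field. -/
def tangentialDensity (T V : ℝ → E3) (t : ℝ) : ℝ := inner ℝ (T t) (cross (deriv T t) (deriv V t))

/-- The variation of `tangentialDensity`, if `A` and `W` are the variations of the curve and of
the field `V`. -/
def tangentialDensityVar (T V A W : ℝ → E3) (t : ℝ) : ℝ :=
  inner ℝ (deriv A t) (cross (deriv T t) (deriv V t)) +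
    inner ℝ (T t) (cross (deriv (deriv A) t) (deriv V t)) +
    inner ℝ (T t) (cross (deriv T t) (deriv W t))

/-- The balanced locally arclength preserving solution `W` of `V' = T × W`. -/
def nextField (T V : ℝ → E3) (s : ℝ) : E3 :=
  -cross (T s) (deriv V s) + antiD (tangentialDensity T V) s • T s

/-- The variation of `nextField`. -/
def nextVar (T V A W : ℝ → E3) (s : ℝ) : E3 :=
  -cross (deriv A s) (deriv V s) - cross (T s) (deriv W s)
    + antiD (tangentialDensityVar T V A W) s • T s + antiD (tangentialDensity T V) s • deriv A s

/-- The recursion on jets. -/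
def Jet.next (T : ℝ → E3) (J : Jet) : Jet :=
  ⟨nextField T J.field, fun A => nextVar T J.field A (J.var A)⟩

/-- Jets of locally arclength preserving fields to which the recursion applies. -/
structure Jet.Good (T : ℝ → E3) (J : Jet) : Prop where
  diff : Differentiable ℝ J.field
  sch : IsSch (deriv J.field)
  perp : ∀ s, inner ℝ (T s) (deriv J.field s) = (0 : ℝ)
  diff_var : ∀ A, IsDirection T A → Differentiable ℝ (J.var A)
  sch_var : ∀ A, IsDirection T A → IsSch (deriv (J.var A))
  perp_var : ∀ A, IsDirection T A → ∀ s,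
    inner ℝ (T s) (deriv (J.var A) s) + inner ℝ (deriv A s) (deriv J.field s) = (0 : ℝ)
  add : ∀ A B, IsDirection T A → IsDirection T B → J.var (A + B) = J.var A + J.var B
  smul : ∀ (c : ℝ) A, IsDirection T A → J.var (c • A) = c • J.var A

/-- `K` is the successor of `J`: `J' = T × K`, together with the variation of this relation. -/
structure Jet.Succ (T : ℝ → E3) (J K : Jet) : Prop where
  field : ∀ s, HasDerivAt J.field (cross (T s) (K.field s)) s
  var : ∀ A, IsDirection T A → ∀ s,
    HasDerivAt (J.var A) (cross (deriv A s) (K.field s) + cross (T s) (K.var A s)) s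

/-- Jets that are balanced, with balanced variations. -/
structure Jet.Regular (T : ℝ → E3) (J : Jet) : Prop extends J.Good T where
  balanced : Balanced T J.field
  balanced_var : ∀ A, IsDirection T A → Balanced T (J.var A)

section

variable {T : ℝ → E3}

lemma Jet.Regular.isDirection {J : Jet} (hJ : J.Regular T) : IsDirection T J.field :=
  ⟨hJ.balanced, hJ.perp⟩

lemma IsDirection.hasDerivAt (hT : IsIndicatrix T) {A : ℝ → E3} (hA : IsDirection T A) (s : ℝ) :
    HasDerivAt A (deriv A s) s := (hA.balanced.differentiable hT s).hasDerivAt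

lemma IsDirection.sch (hT : IsIndicatrix T) {A : ℝ → E3} (hA : IsDirection T A) :
    IsSch (deriv A) := hA.balanced.sch_deriv hT

lemma IsDirection.smul (hT : IsIndicatrix T) {A : ℝ → E3} (c : ℝ) (hA : IsDirection T A) :
    IsDirection T (c • A) := by
  refine ⟨hA.balanced.smul c, fun s => ?_⟩
  rw [((hA.hasDerivAt hT s).const_smul c).deriv, inner_smul_right, hA.perp, mul_zero]

lemma deriv_add_of {A B : ℝ → E3} (hA : Differentiable ℝ A) (hB : Differentiable ℝ B) :
    deriv (A + B) = deriv A + deriv B := funext fun s => deriv_add (hA s) (hB s)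

lemma deriv_smul_of {A : ℝ → E3} (c : ℝ) (hA : Differentiable ℝ A) :
    deriv (c • A) = c • deriv A := funext fun s => deriv_const_smul c (hA s)

lemma isSch_tangentialDensity (hT : IsIndicatrix T) {V : ℝ → E3} (hV : IsSch (deriv V)) :
    IsSch (tangentialDensity T V) :=
  (hT.sch.cross_temperate hV.hasTemperateGrowth).temperate_inner hT.temperate

lemma isSch_tangentialDensityVar (hT : IsIndicatrix T) {V A W : ℝ → E3} (hV : IsSch (deriv V))
    (hA : IsSch (deriv A)) (hW : IsSch (deriv W)) : IsSch (tangentialDensityVar T V A W) :=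
  (((hT.sch.cross_temperate hV.hasTemperateGrowth).temperate_inner hA.hasTemperateGrowth).add
    ((hA.deriv.cross_temperate hV.hasTemperateGrowth).temperate_inner hT.temperate)).add
    ((hT.sch.cross_temperate hW.hasTemperateGrowth).temperate_inner hT.temperate)

lemma balanced_nextField (hT : IsIndicatrix T) {V : ℝ → E3} (hV : IsSch (deriv V)) :
    Balanced T (nextField T V) :=
  ⟨_, _, (hV.temperate_cross hT.temperate).neg, isSch_tangentialDensity hT hV, rfl⟩

/-- The term `antiD (tangentialDensity T V) • deriv A` is not tangential, but it is Schwartz because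
`deriv A` is, so it joins the Schwartz part. -/
lemma balanced_nextVar (hT : IsIndicatrix T) {V A W : ℝ → E3} (hV : IsSch (deriv V))
    (hA : IsSch (deriv A)) (hW : IsSch (deriv W)) : Balanced T (nextVar T V A W) := by
  refine ⟨_, _, (((hA.cross_temperate hV.hasTemperateGrowth).neg.sub
    (hW.temperate_cross hT.temperate))).add
    (hA.temperate_smul (isSch_tangentialDensity hT hV).temperate_antiD),
    isSch_tangentialDensityVar hT hV hA hW, ?_⟩
  ext1 s
  rw [nextVar]
  module

/-- On vectors orthogonal to T, the map -T × (T × ·) is the identity; the tangential term of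
`nextField` is invisible to T ×. -/
lemma cross_nextField (hT : IsIndicatrix T) {V : ℝ → E3}
    (hp : ∀ s, inner ℝ (T s) (deriv V s) = (0 : ℝ)) (s : ℝ) :
    cross (T s) (nextField T V s) = deriv V s := by
  rw [nextField, cross_add, cross_neg, cross_cross, hp, hT.inner_self, cross_smul, cross_self]
  module

/-- The linearization of `cross_nextField`: `hW` is the linearized orthogonality of `V`, and it
turns ⟨A', V'⟩ into -⟨T, W'⟩. -/
lemma cross_nextVar (hT : IsIndicatrix T) {V A W : ℝ → E3}
    (hV : ∀ s, inner ℝ (T s) (deriv V s) = (0 : ℝ))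
    (hA : ∀ s, inner ℝ (T s) (deriv A s) = (0 : ℝ))
    (hW : ∀ s, inner ℝ (T s) (deriv W s) + inner ℝ (deriv A s) (deriv V s) = (0 : ℝ)) (s : ℝ) :
    cross (deriv A s) (nextField T V s) + cross (T s) (nextVar T V A W s) = deriv W s := by
  have h1 : inner ℝ (deriv A s) (deriv V s) = -(inner ℝ (T s) (deriv W s) : ℝ) := by
    linarith [hW s]
  simp only [nextField, nextVar, cross_add, cross_neg, cross_sub, cross_smul, cross_cross,
    cross_self, hV, hA, hT.inner_self, real_inner_comm (T s) (deriv A s), h1,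
    cross_anticomm (deriv A s) (T s)]
  module

lemma hasDerivAt_nextField (hT : IsIndicatrix T) {V : ℝ → E3} (hV : IsSch (deriv V)) (s : ℝ) :
    HasDerivAt (nextField T V) (-(cross (deriv T s) (deriv V s) + cross (T s) (deriv (deriv V) s))
      + (antiD (tangentialDensity T V) s • deriv T s + tangentialDensity T V s • T s)) s :=
  (hasDerivAt_cross (hT.hasDerivAt s) (hV.differentiable s).hasDerivAt).neg.add
    (((isSch_tangentialDensity hT hV).hasDerivAt_antiD s).smul (hT.hasDerivAt s))

lemma hasDerivAt_nextVar (hT : IsIndicatrix T) {V A W : ℝ → E3} (hV : IsSch (deriv V))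
    (hA : IsSch (deriv A)) (hW : IsSch (deriv W)) (s : ℝ) :
    HasDerivAt (nextVar T V A W)
      (-(cross (deriv (deriv A) s) (deriv V s) + cross (deriv A s) (deriv (deriv V) s))
        - (cross (deriv T s) (deriv W s) + cross (T s) (deriv (deriv W) s))
        + (antiD (tangentialDensityVar T V A W) s • deriv T s
          + tangentialDensityVar T V A W s • T s)
        + (antiD (tangentialDensity T V) s • deriv (deriv A) s
          + tangentialDensity T V s • deriv A s)) s :=
  (((hasDerivAt_cross (hA.differentiable s).hasDerivAt (hV.differentiable s).hasDerivAt).neg.sub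
    (hasDerivAt_cross (hT.hasDerivAt s) (hW.differentiable s).hasDerivAt)).add
    (((isSch_tangentialDensityVar hT hV hA hW).hasDerivAt_antiD s).smul (hT.hasDerivAt s))).add
    (((isSch_tangentialDensity hT hV).hasDerivAt_antiD s).smul (hA.differentiable s).hasDerivAt)

/-- Differentiation of an orthogonality relation `⟪T, A'⟫ = 0`. -/
lemma inner_deriv_deriv (hT : IsIndicatrix T) {A : ℝ → E3} (hA : IsSch (deriv A))
    (hp : ∀ s, inner ℝ (T s) (deriv A s) = (0 : ℝ)) (s : ℝ) :
    inner ℝ (T s) (deriv (deriv A) s) + inner ℝ (deriv A s) (deriv T s) = (0 : ℝ) := by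
  have h := (hT.hasDerivAt s).inner ℝ (hA.differentiable s).hasDerivAt
  simp only [hp] at h
  have := h.unique (hasDerivAt_const s (0 : ℝ))
  rwa [real_inner_comm (deriv A s) (deriv T s)] at this

/-- The T-component of (T × V')' is ⟨T, T' × V'⟩, and `tangentialDensity` was chosen to cancel it.
-/
lemma perp_nextField (hT : IsIndicatrix T) {V : ℝ → E3} (hV : IsSch (deriv V)) (s : ℝ) :
    inner ℝ (T s) (deriv (nextField T V) s) = (0 : ℝ) := by
  rw [(hasDerivAt_nextField hT hV s).deriv]
  simp only [inner_add_right, inner_neg_right, inner_smul_right, hT.inner_deriv, hT.inner_self,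
    inner_self_cross, tangentialDensity]
  ring

/-- The linearization of `perp_nextField`. The terms with V'' cancel by antisymmetry of the triple
product, and those with the antiderivative by the differentiated relation ⟨T, A'⟩ = 0. -/
lemma perp_nextVar (hT : IsIndicatrix T) {V A W : ℝ → E3} (hV : IsSch (deriv V))
    (hA : IsSch (deriv A)) (hW : IsSch (deriv W))
    (hpA : ∀ s, inner ℝ (T s) (deriv A s) = (0 : ℝ)) (s : ℝ) :
    inner ℝ (T s) (deriv (nextVar T V A W) s) + inner ℝ (deriv A s) (deriv (nextField T V) s)
      = (0 : ℝ) := by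
  rw [(hasDerivAt_nextField hT hV s).deriv, (hasDerivAt_nextVar hT hV hA hW s).deriv]
  have h1 := inner_deriv_deriv hT hA hpA s
  have h2 := inner_cross_swap (T s) (deriv A s) (deriv (deriv V) s)
  simp only [inner_add_right, inner_neg_right, inner_sub_right, inner_smul_right, hT.inner_deriv,
    hT.inner_self, inner_self_cross, tangentialDensity, tangentialDensityVar, hpA,
    real_inner_comm (T s) (deriv A s)]
  linear_combination (antiD (tangentialDensity T V) s) * h1 - h2

lemma antiD_tangentialDensityVar_add (hT : IsIndicatrix T) {V A B W Z : ℝ → E3}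
    (hV : IsSch (deriv V)) (hA : IsSch (deriv A)) (hB : IsSch (deriv B)) (hW : IsSch (deriv W))
    (hZ : IsSch (deriv Z)) (hdA : deriv (A + B) = deriv A + deriv B)
    (hdW : deriv (W + Z) = deriv W + deriv Z) (s : ℝ) :
    antiD (tangentialDensityVar T V (A + B) (W + Z)) s =
      antiD (tangentialDensityVar T V A W) s + antiD (tangentialDensityVar T V B Z) s := by
  rw [← antiD_add (isSch_tangentialDensityVar hT hV hA hW).integrable
    (isSch_tangentialDensityVar hT hV hB hZ).integrable]
  congr 1
  ext1 t
  simp only [tangentialDensityVar, hdA, hdW, deriv_add_of hA.differentiable hB.differentiable,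
    Pi.add_apply, add_cross, cross_add, inner_add_left, inner_add_right]
  ring

lemma antiD_tangentialDensityVar_smul {V A W : ℝ → E3} (c : ℝ) (hA : IsSch (deriv A))
    (hdA : deriv (c • A) = c • deriv A) (hdW : deriv (c • W) = c • deriv W) (s : ℝ) :
    antiD (tangentialDensityVar T V (c • A) (c • W)) s =
      c * antiD (tangentialDensityVar T V A W) s := by
  rw [← antiD_const_mul]
  congr 1
  ext1 t
  simp only [tangentialDensityVar, hdA, hdW, deriv_smul_of c hA.differentiable,
    Pi.smul_apply, smul_cross, cross_smul, inner_smul_left, inner_smul_right]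
  simp
  ring

/-- One step gains balance: only derivatives of the old field and of its variation enter, and these
are Schwartz. The recursion may thus start from an unbalanced field. -/
lemma Jet.Good.next (hT : IsIndicatrix T) {J : Jet} (hJ : J.Good T) :
    (J.next T).Regular T where
  diff s := (hasDerivAt_nextField hT hJ.sch s).differentiableAt
  sch := (balanced_nextField hT hJ.sch).sch_deriv hT
  perp := perp_nextField hT hJ.sch
  diff_var A hA := (balanced_nextVar hT hJ.sch (hA.sch hT) (hJ.sch_var A hA)).differentiable hT
  sch_var A hA := (balanced_nextVar hT hJ.sch (hA.sch hT) (hJ.sch_var A hA)).sch_deriv hT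
  perp_var A hA := perp_nextVar hT hJ.sch (hA.sch hT) (hJ.sch_var A hA) hA.perp
  balanced := balanced_nextField hT hJ.sch
  balanced_var A hA := balanced_nextVar hT hJ.sch (hA.sch hT) (hJ.sch_var A hA)
  add A B hA hB := by
    have hdA := deriv_add_of (hA.balanced.differentiable hT) (hB.balanced.differentiable hT)
    have hdW := deriv_add_of (hJ.diff_var A hA) (hJ.diff_var B hB)
    ext1 s
    simp only [Jet.next, nextVar, hJ.add A B hA hB, Pi.add_apply]
    rw [antiD_tangentialDensityVar_add hT hJ.sch (hA.sch hT) (hB.sch hT) (hJ.sch_var A hA)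
      (hJ.sch_var B hB) hdA hdW, hdA, hdW]
    simp only [Pi.add_apply, add_cross, cross_add]
    module
  smul c A hA := by
    have hdA := deriv_smul_of c (hA.balanced.differentiable hT)
    have hdW := deriv_smul_of c (hJ.diff_var A hA)
    ext1 s
    simp only [Jet.next, nextVar, hJ.smul c A hA, Pi.smul_apply]
    rw [antiD_tangentialDensityVar_smul c (hA.sch hT) hdA hdW, hdA, hdW]
    simp only [Pi.smul_apply, smul_cross, cross_smul]
    module

lemma Jet.Good.succ (hT : IsIndicatrix T) {J : Jet} (hJ : J.Good T) : J.Succ T (J.next T) where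
  field s := by
    have := (hJ.diff s).hasDerivAt
    rwa [← cross_nextField hT hJ.perp s] at this
  var A hA s := by
    have := (hJ.diff_var A hA s).hasDerivAt
    rwa [← cross_nextVar hT hJ.perp hA.perp (hJ.perp_var A hA) s] at this

/-! ## Commutators of jets -/

/-- The commutator of the fields of two jets. -/
def bracket (J K : Jet) (s : ℝ) : E3 := K.var J.field s - J.var K.field s

/-- The Lie derivative of the recursion along a field `A` with successor `A'`, given by the jets
`J` and `K`, applied to a field `V` with successor `W`. -/
def lieRec (J K : Jet) (V W : ℝ → E3) (s : ℝ) : E3 :=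
  K.var V s - J.var W s - cross (K.field s) (W s)

/-- This is heredity of the recursion, L_{RA} R = R ∘ L_A R. The three double products that remain
after differentiation collapse to T × (L × W) by the Jacobi identity, while those with W' cancel by
antisymmetry. -/
lemma cross_lieRec (hT : IsIndicatrix T) {J K L : Jet} (hJK : J.Succ T K) (hKL : K.Succ T L)
    {V W : ℝ → E3} (hV : IsDirection T V) (hW : IsDirection T W)
    (hVW : ∀ s, deriv V s = cross (T s) (W s)) (s : ℝ) :
    HasDerivAt (lieRec J K V W) (cross (T s) (lieRec K L V W s)) s := by
  have h := ((hKL.var V hV s).sub (hJK.var W hW s)).sub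
    (hasDerivAt_cross (hKL.field s) (hW.hasDerivAt hT s))
  refine h.congr_deriv ?_
  simp only [lieRec, cross_sub, hVW]
  rw [cross_leibniz (T s) (L.field s) (W s), cross_anticomm (deriv W s) (K.field s),
    cross_anticomm (L.field s) (cross (T s) (W s))]
  abel

/-- The product rule R[A, V] = [A, RV] - (L_A R)V, with R expressed by derivatives; the correction
by a vector product in `lieRec` is what the Jacobi identity produces. -/
lemma hasDerivAt_bracket {J J' K K' : Jet} (hJ : J.Succ T J')
    (hK : K.Succ T K') (hJd : IsDirection T J.field) (hKd : IsDirection T K.field) (s : ℝ) :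
    HasDerivAt (bracket J K) (cross (T s) (bracket J K' s - lieRec J J' K.field K'.field s)) s := by
  refine ((hK.var _ hJd s).sub (hJ.var _ hKd s)).congr_deriv ?_
  rw [(hJ.field s).deriv, (hK.field s).deriv]
  simp only [lieRec, bracket, cross_sub]
  rw [cross_leibniz (T s) (J'.field s) (K'.field s),
    cross_anticomm (cross (T s) (K'.field s)) (J'.field s)]
  abel

lemma Jet.Regular.balanced_bracket {J K : Jet} (hJ : J.Regular T) (hK : K.Regular T) :
    Balanced T (bracket J K) :=
  (hK.balanced_var _ hJ.isDirection).sub (hJ.balanced_var _ hK.isDirection)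

end

/-! ## The two hierarchies and their commutators -/

/-- The combination `b • (γ - s T) - c • T` of the generators of scalings and of translations of
the parameter. -/
def startJet (γ T : ℝ → E3) (b c : ℝ) : Jet :=
  ⟨fun s => b • γ s - (b * s + c) • T s, fun A s => b • A s - (b * s + c) • deriv A s⟩

/-- The jets obtained from `startJet` by iterating the recursion. -/
def chain (γ T : ℝ → E3) (b c : ℝ) : ℕ → Jet
  | 0 => startJet γ T b c
  | n + 1 => (chain γ T b c n).next T

section

variable {γ T : ℝ → E3}

lemma hasDerivAt_affine (b c s : ℝ) : HasDerivAt (fun s : ℝ => b * s + c) b s := by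
  simpa using ((hasDerivAt_id s).const_mul b).add_const c

lemma temperate_affine (b c : ℝ) : (fun s : ℝ => b * s + c).HasTemperateGrowth :=
  ((Function.HasTemperateGrowth.const b).mul Function.HasTemperateGrowth.id').add
    (Function.HasTemperateGrowth.const c)

lemma hasDerivAt_startJet_field (hT : IsIndicatrix T) (hγ : ∀ s, HasDerivAt γ (T s) s)
    (b c s : ℝ) :
    HasDerivAt (startJet γ T b c).field (-((b * s + c) • deriv T s)) s := by
  refine (((hγ s).const_smul b).sub
    ((hasDerivAt_affine b c s).smul (hT.hasDerivAt s))).congr_deriv ?_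
  module

lemma hasDerivAt_startJet_var (hT : IsIndicatrix T) (b c : ℝ) {A : ℝ → E3}
    (hA : IsDirection T A) (s : ℝ) :
    HasDerivAt ((startJet γ T b c).var A) (-((b * s + c) • deriv (deriv A) s)) s := by
  refine (((hA.hasDerivAt hT s).const_smul b).sub
    ((hasDerivAt_affine b c s).smul ((hA.sch hT).differentiable s).hasDerivAt)).congr_deriv ?_
  module

lemma startJet_good (hT : IsIndicatrix T) (hγ : ∀ s, HasDerivAt γ (T s) s) (b c : ℝ) :
    (startJet γ T b c).Good T where
  diff s := (hasDerivAt_startJet_field hT hγ b c s).differentiableAt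
  sch := by
    rw [show deriv (startJet γ T b c).field = _ from
      funext fun s => (hasDerivAt_startJet_field hT hγ b c s).deriv]
    exact (hT.sch.temperate_smul (temperate_affine b c)).neg
  perp s := by
    rw [(hasDerivAt_startJet_field hT hγ b c s).deriv, inner_neg_right, inner_smul_right,
      hT.inner_deriv, mul_zero, neg_zero]
  diff_var A hA s := (hasDerivAt_startJet_var hT b c hA s).differentiableAt
  sch_var A hA := by
    rw [show deriv ((startJet γ T b c).var A) = _ from
      funext fun s => (hasDerivAt_startJet_var hT b c hA s).deriv]
    exact ((hA.sch hT).deriv.temperate_smul (temperate_affine b c)).neg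
  perp_var A hA s := by
    rw [(hasDerivAt_startJet_field hT hγ b c s).deriv,
      (hasDerivAt_startJet_var hT b c hA s).deriv]
    simp only [inner_neg_right, inner_smul_right]
    linear_combination (-(b * s + c)) * inner_deriv_deriv hT (hA.sch hT) hA.perp s
  add A B hA hB := by
    ext1 s
    simp only [startJet, Pi.add_apply,
      deriv_add_of (hA.balanced.differentiable hT) (hB.balanced.differentiable hT)]
    module
  smul r A hA := by
    ext1 s
    simp only [startJet, Pi.smul_apply, deriv_smul_of r (hA.balanced.differentiable hT)]
    module

lemma chain_good (hT : IsIndicatrix T) (hγ : ∀ s, HasDerivAt γ (T s) s) (b c : ℝ) :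
    ∀ n, (chain γ T b c n).Good T
  | 0 => startJet_good hT hγ b c
  | n + 1 => ((chain_good hT hγ b c n).next hT).toGood

/-- The index 0 is excluded because γ - sT and T need not be balanced. -/
lemma chain_regular (hT : IsIndicatrix T) (hγ : ∀ s, HasDerivAt γ (T s) s) (b c : ℝ) {n : ℕ}
    (hn : 1 ≤ n) : (chain γ T b c n).Regular T := by
  obtain ⟨n, rfl⟩ := Nat.exists_eq_add_of_le' hn
  exact (chain_good hT hγ b c n).next hT

lemma chain_succ (hT : IsIndicatrix T) (hγ : ∀ s, HasDerivAt γ (T s) s) (b c : ℝ) (n : ℕ) :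
    (chain γ T b c n).Succ T (chain γ T b c (n + 1)) :=
  (chain_good hT hγ b c n).succ hT

lemma deriv_chain (hT : IsIndicatrix T) (hγ : ∀ s, HasDerivAt γ (T s) s) (b c : ℝ) (n : ℕ)
    (s : ℝ) : deriv (chain γ T b c n).field s = cross (T s) ((chain γ T b c (n + 1)).field s) :=
  ((chain_succ hT hγ b c n).field s).deriv

/-- The derivative of the starting field is a multiple of T', so the density ⟨T, T' × T'⟩ vanishes
and no tangential part arises. -/
lemma chain_one_field (hT : IsIndicatrix T) (hγ : ∀ s, HasDerivAt γ (T s) s) (b c : ℝ) :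
    (chain γ T b c 1).field = fun s => (b * s + c) • cross (T s) (deriv T s) := by
  have h : tangentialDensity T (startJet γ T b c).field = fun _ => 0 := by
    ext1 t
    rw [tangentialDensity, (hasDerivAt_startJet_field hT hγ b c t).deriv, cross_neg, cross_smul,
      cross_self, smul_zero, neg_zero, inner_zero_right]
  ext1 s
  simp only [chain, Jet.next, nextField]
  rw [h, (hasDerivAt_startJet_field hT hγ b c s).deriv, antiD_zero, cross_neg, cross_smul]
  module

/-- The variation of the vanishing density vanishes too: its terms ⟨T, A'' × T'⟩ and ⟨T, T' × A''⟩
occur with the same factor and cancel. -/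
lemma chain_one_var (hT : IsIndicatrix T) (hγ : ∀ s, HasDerivAt γ (T s) s) (b c : ℝ)
    {A : ℝ → E3} (hA : IsDirection T A) :
    (chain γ T b c 1).var A = fun s => (b * s + c) •
      (cross (deriv A s) (deriv T s) + cross (T s) (deriv (deriv A) s)) := by
  have h : tangentialDensity T (startJet γ T b c).field = fun _ => 0 := by
    ext1 t
    rw [tangentialDensity, (hasDerivAt_startJet_field hT hγ b c t).deriv, cross_neg, cross_smul,
      cross_self, smul_zero, neg_zero, inner_zero_right]
  have h' : tangentialDensityVar T (startJet γ T b c).field A ((startJet γ T b c).var A)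
      = fun _ => 0 := by
    ext1 t
    rw [tangentialDensityVar, (hasDerivAt_startJet_field hT hγ b c t).deriv,
      (hasDerivAt_startJet_var hT b c hA t).deriv, cross_neg, cross_smul,
      cross_self, smul_zero, neg_zero, inner_zero_right, cross_neg, cross_neg, cross_smul,
      cross_smul, cross_anticomm (deriv (deriv A) t)]
    simp only [inner_neg_right, inner_smul_right]
    ring
  ext1 s
  simp only [chain, Jet.next, nextVar]
  rw [h, h', (hasDerivAt_startJet_field hT hγ b c s).deriv,
    (hasDerivAt_startJet_var hT b c hA s).deriv, antiD_zero, cross_neg, cross_smul, cross_neg,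
    cross_smul]
  module

/-- Of the jet at `i`, only the variation enters `lieRec`, not the field. Hence `i = 0` is
admissible, where the variation bW - (bs + c)W' is balanced although the field may fail to be. -/
lemma balanced_lieRec (hT : IsIndicatrix T) (hγ : ∀ s, HasDerivAt γ (T s) s) (b c : ℝ) (i : ℕ)
    {V W : ℝ → E3} (hV : IsDirection T V) (hW : IsDirection T W) :
    Balanced T (lieRec (chain γ T b c i) (chain γ T b c (i + 1)) V W) := by
  have hr := chain_regular hT hγ b c (Nat.le_add_left 1 i)
  have hi : Balanced T ((chain γ T b c i).var W) := by
    cases i with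
    | zero =>
      exact (hW.balanced.smul b).sub
        ((hW.sch hT).temperate_smul (temperate_affine b c)).balanced
    | succ i => exact (chain_regular hT hγ b c (Nat.le_add_left 1 i)).balanced_var W hW
  exact ((hr.balanced_var V hV).sub hi).sub (balanced_cross hT hr.balanced hW.balanced)

/-- The base value L R = -bR, up to tangential terms. The successor relation for the starting jet
determines T × V_1 and T × (variation of V_1), which suffices here; the tangential part is recovered
by uniqueness in `lieRec_chain`. -/
lemma cross_lieRec_zero (hT : IsIndicatrix T) (hγ : ∀ s, HasDerivAt γ (T s) s) (b c : ℝ)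
    {V W : ℝ → E3} (hV : IsDirection T V) (hW : IsDirection T W)
    (hVW : ∀ s, deriv V s = cross (T s) (W s)) (s : ℝ) :
    cross (T s) (lieRec (chain γ T b c 0) (chain γ T b c 1) V W s) = -(b • cross (T s) (W s)) := by
  have h1 := ((chain_succ hT hγ b c 0).var V hV s).unique (hasDerivAt_startJet_var hT b c hV s)
  have h2 := ((chain_succ hT hγ b c 0).field s).unique (hasDerivAt_startJet_field hT hγ b c s)
  have h3 : deriv (deriv V) s = cross (deriv T s) (W s) + cross (T s) (deriv W s) := by
    rw [show deriv V = fun s => cross (T s) (W s) from funext hVW]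
    exact (hasDerivAt_cross (hT.hasDerivAt s) (hW.hasDerivAt hT s)).deriv
  rw [hVW, h3] at h1
  have h1' := eq_sub_of_add_eq' h1
  have h4 := cross_leibniz (T s) ((chain γ T b c 1).field s) (W s)
  rw [zero_add] at h1' h2
  rw [h2, neg_cross, smul_cross, cross_anticomm ((chain γ T b c 1).field s) (cross (T s) (W s))] at h4
  simp only [lieRec, cross_sub, h1', h4]
  simp only [chain, startJet, cross_sub, cross_smul]
  module

/-- The Lie derivative of the recursion along a member of the hierarchies. -/
lemma lieRec_chain (hT : IsIndicatrix T) (hγ : ∀ s, HasDerivAt γ (T s) s) (b c b' c' : ℝ)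
    (i : ℕ) {j : ℕ} (hj : 1 ≤ j) :
    lieRec (chain γ T b c i) (chain γ T b c (i + 1)) (chain γ T b' c' j).field
      (chain γ T b' c' (j + 1)).field = -(b • (chain γ T b' c' (i + j + 1)).field) := by
  have hV := (chain_regular hT hγ b' c' hj).isDirection
  have hW := (chain_regular hT hγ b' c' (Nat.le_add_left 1 j)).isDirection
  have hVW := deriv_chain hT hγ b' c' j
  -- The difference of the two sides is balanced, and its derivative is orthogonal to T since both
  -- are derivatives of fields with a successor. Equality after T × is therefore enough.
  have key : ∀ i, (∀ s, cross (T s) (lieRec (chain γ T b c i) (chain γ T b c (i + 1))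
      (chain γ T b' c' j).field (chain γ T b' c' (j + 1)).field s) =
      -(b • cross (T s) ((chain γ T b' c' (i + j + 1)).field s))) →
      lieRec (chain γ T b c i) (chain γ T b c (i + 1)) (chain γ T b' c' j).field
      (chain γ T b' c' (j + 1)).field = -(b • (chain γ T b' c' (i + j + 1)).field) := by
    intro i hi
    have hR := chain_regular hT hγ b' c' (Nat.le_add_left 1 (i + j))
    have hd := fun s => (cross_lieRec hT (chain_succ hT hγ b c i) (chain_succ hT hγ b c (i + 1))
      hV hW hVW s).add ((hR.isDirection.hasDerivAt hT s).const_smul b)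
    refine eq_neg_of_add_eq_zero_left (Balanced.eq_zero hT
      ((balanced_lieRec hT hγ b c i hV hW).add (hR.balanced.smul b)) (fun s => ?_) fun s => ?_)
    · rw [(hd s).deriv, inner_add_right, inner_smul_right, hR.perp, inner_self_cross]
      simp
    · rw [Pi.add_apply, cross_add, hi s, Pi.smul_apply, cross_smul]
      simp
  induction i with
  | zero =>
    refine key 0 fun s => ?_
    rw [cross_lieRec_zero hT hγ b c hV hW hVW s, zero_add]
  | succ i ih =>
    refine key (i + 1) fun s => ?_
    have hR := chain_regular hT hγ b' c' (Nat.le_add_left 1 (i + j))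
    -- By heredity, T × of the quantity at i + 1 is the derivative of the quantity at i, known by
    -- induction.
    have h1 := cross_lieRec hT (chain_succ hT hγ b c i) (chain_succ hT hγ b c (i + 1)) hV hW hVW s
    rw [ih] at h1
    have h2 := h1.unique ((hR.isDirection.hasDerivAt hT s).const_smul b).neg
    rw [h2, deriv_chain hT hγ, show i + 1 + j + 1 = i + j + 1 + 1 by ring]

/-- A step of the recursion for the commutators. -/
lemma bracket_chain_succ (hT : IsIndicatrix T) (hγ : ∀ s, HasDerivAt γ (T s) s) (b c b' c' : ℝ)
    {i j : ℕ} (hi : 1 ≤ i) (hj : 1 ≤ j) {Z Z' : ℝ → E3} (hZ' : IsDirection T Z')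
    (hZ : ∀ s, deriv Z s = cross (T s) (Z' s))
    (h : bracket (chain γ T b c i) (chain γ T b' c' j) = Z) :
    bracket (chain γ T b c i) (chain γ T b' c' (j + 1)) =
      Z' - b • (chain γ T b' c' (i + j + 1)).field := by
  have hJ := chain_regular hT hγ b c hi
  have hK := chain_regular hT hγ b' c' hj
  have hK' := chain_regular hT hγ b' c' (Nat.le_add_left 1 j)
  have hR := chain_regular hT hγ b' c' (Nat.le_add_left 1 (i + j))
  have hd := fun s => hasDerivAt_bracket (chain_succ hT hγ b c i) (chain_succ hT hγ b' c' j)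
    hJ.isDirection hK.isDirection s
  have hd' := fun s => hasDerivAt_bracket (chain_succ hT hγ b c i) (chain_succ hT hγ b' c' (j + 1))
    hJ.isDirection hK'.isDirection s
  refine sub_eq_zero.mp (Balanced.eq_zero hT ((hJ.balanced_bracket hK').sub
    (hZ'.balanced.sub (hR.balanced.smul b))) (fun s => ?_) fun s => ?_)
  · rw [((hd' s).sub ((hZ'.hasDerivAt hT s).sub
      ((hR.isDirection.hasDerivAt hT s).const_smul b))).deriv]
    simp only [inner_sub_right, inner_smul_right, inner_self_cross, hZ'.perp, hR.perp]
    ring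
  -- The derivative of the old commutator is read in two ways, as T × Z' and by the product rule;
  -- this fixes T × of the new commutator.
  · have h1 := (hd s).deriv
    rw [h, hZ, lieRec_chain hT hγ b c b' c' i hj, cross_sub] at h1
    simp only [Pi.sub_apply, Pi.smul_apply, Pi.neg_apply, cross_sub, cross_neg, cross_smul]
      at h1 ⊢
    rw [h1]
    module

/-! ### Evaluation of the commutators by induction on both indices -/

lemma bracket_swap (J K : Jet) : bracket K J = -bracket J K := by
  ext1 s; simp [bracket]

lemma bracket_self (J : Jet) : bracket J J = 0 := by
  ext1 s; simp [bracket]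

lemma isDirection_zero (T : ℝ → E3) : IsDirection T 0 :=
  ⟨IsSch.zero.balanced, fun s => by simp⟩

/-- For b = 0 a step sends zero to zero. Steps raise only the second index, so the first is raised
by antisymmetry from the bracket of the first member with itself. -/
lemma bracket_symmetries (hT : IsIndicatrix T) (hγ : ∀ s, HasDerivAt γ (T s) s) {i j : ℕ}
    (hi : 1 ≤ i) (hj : 1 ≤ j) : bracket (chain γ T 0 1 i) (chain γ T 0 1 j) = 0 := by
  have step : ∀ {i j : ℕ}, 1 ≤ i → 1 ≤ j → bracket (chain γ T 0 1 i) (chain γ T 0 1 j) = 0 →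
      bracket (chain γ T 0 1 i) (chain γ T 0 1 (j + 1)) = 0 := by
    intro i j hi hj h
    rw [bracket_chain_succ hT hγ 0 1 0 1 hi hj (isDirection_zero T)
      (fun s => by simp [cross_zero]) h]
    simp
  have base : ∀ i, 1 ≤ i → bracket (chain γ T 0 1 1) (chain γ T 0 1 i) = 0 := by
    intro i hi
    induction i, hi using Nat.le_induction with
    | base => exact bracket_self _
    | succ i hi ih => exact step le_rfl hi ih
  induction j, hj using Nat.le_induction with
  | base => rw [bracket_swap, base i hi, neg_zero]
  | succ j hj ih => exact step hi hj ih

lemma deriv_smul_chain (hT : IsIndicatrix T) (hγ : ∀ s, HasDerivAt γ (T s) s) (a b c : ℝ)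
    (n : ℕ) (s : ℝ) : deriv (a • (chain γ T b c n).field) s =
      cross (T s) ((a • (chain γ T b c (n + 1)).field) s) := by
  rw [deriv_smul_of a (chain_good hT hγ b c n).diff, Pi.smul_apply, deriv_chain hT hγ,
    Pi.smul_apply, cross_smul]

/-- The one commutator that is computed by hand. With A = T × T' = V_1 for (b, c) = (0, 1), the
other field is sA, and all terms with a factor s cancel; there remains -A × T' - 2 T × A', whose
product with T is 2A'. -/
lemma bracket_one_one (hT : IsIndicatrix T) (hγ : ∀ s, HasDerivAt γ (T s) s) :
    bracket (chain γ T 0 1 1) (chain γ T 1 0 1) = (2 : ℝ) • (chain γ T 0 1 2).field := by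
  have hP := chain_regular hT hγ 0 1 (le_refl 1)
  have hQ := chain_regular hT hγ 1 0 (le_refl 1)
  have hR := chain_regular hT hγ 0 1 (show 1 ≤ 2 by norm_num)
  have hd := fun s => hasDerivAt_bracket (chain_succ hT hγ 0 1 1) (chain_succ hT hγ 1 0 1)
    hP.isDirection hQ.isDirection s
  refine sub_eq_zero.mp (Balanced.eq_zero hT ((hP.balanced_bracket hQ).sub
    (hR.balanced.smul 2)) (fun s => ?_) fun s => ?_)
  · rw [((hd s).sub ((hR.isDirection.hasDerivAt hT s).const_smul (2 : ℝ))).deriv, inner_sub_right,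
      inner_self_cross, inner_smul_right, hR.perp]
    simp
  · have hA : (chain γ T 0 1 1).field = fun s => cross (T s) (deriv T s) := by
      rw [chain_one_field hT hγ]; simp
    have hsA : (chain γ T 1 0 1).field = fun s => s • (chain γ T 0 1 1).field s := by
      rw [chain_one_field hT hγ, hA]; simp
    have hdA := hP.isDirection.hasDerivAt hT
    have hdA' := fun s => ((hP.isDirection.sch hT).differentiable s).hasDerivAt
    have h1 : deriv (chain γ T 1 0 1).field = fun s => (chain γ T 0 1 1).field s +
        s • deriv (chain γ T 0 1 1).field s := by
      ext1 s
      rw [hsA]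
      refine ((hasDerivAt_id' s).smul (hdA s)).deriv.trans ?_
      rw [one_smul, add_comm]
    have h2 : deriv (deriv (chain γ T 1 0 1).field) s =
        (2 : ℝ) • deriv (chain γ T 0 1 1).field s +
          s • deriv (deriv (chain γ T 0 1 1).field) s := by
      rw [h1]
      refine ((hdA s).add ((hasDerivAt_id' s).smul (hdA' s))).deriv.trans ?_
      module
    -- Since A = T × T', the vector A × T' is a multiple of T.
    have h3 : cross (T s) (cross ((chain γ T 0 1 1).field s) (deriv T s)) = 0 := by
      rw [hA]
      beta_reduce
      rw [cross_anticomm (cross (T s) (deriv T s)), cross_cross, cross_neg, cross_sub, cross_smul, cross_smul, cross_self,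
        real_inner_comm (T s) (deriv T s), hT.inner_deriv]
      simp
    have h4 := deriv_chain hT hγ 0 1 1 s
    have h5 := cross_cross (T s) (T s) (deriv (chain γ T 0 1 1).field s)
    rw [hP.perp, hT.inner_self] at h5
    simp only [Pi.sub_apply, Pi.smul_apply, bracket, chain_one_var hT hγ _ _ hP.isDirection,
      chain_one_var hT hγ _ _ hQ.isDirection, h2]
    rw [h1, cross_sub, cross_smul (2 : ℝ), ← h4]
    simp only [zero_mul, zero_add, one_mul, add_zero, one_smul, cross_sub, cross_add, cross_smul,
      add_cross, smul_cross, h3, h5]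
    module

/-- A step on a symmetry, with the first master field fixed (b = 1), lowers the coefficient by one;
a step on a master field, with a symmetry fixed (b = 0), keeps it. The symmetry index is therefore
raised first, in the swapped order. -/
lemma bracket_symmetry_master (hT : IsIndicatrix T) (hγ : ∀ s, HasDerivAt γ (T s) s) {i j : ℕ}
    (hi : 1 ≤ i) (hj : 1 ≤ j) : bracket (chain γ T 0 1 i) (chain γ T 1 0 j) =
      ((i : ℝ) + 1) • (chain γ T 0 1 (i + j)).field := by
  have base : ∀ i : ℕ, 1 ≤ i → bracket (chain γ T 1 0 1) (chain γ T 0 1 i) =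
      (-((i : ℝ) + 1)) • (chain γ T 0 1 (i + 1)).field := by
    intro i hi
    induction i, hi using Nat.le_induction with
    | base =>
      rw [bracket_swap, bracket_one_one hT hγ]
      norm_num
    | succ i hi ih =>
      rw [bracket_chain_succ hT hγ 1 0 0 1 le_rfl hi
        ((chain_regular hT hγ 0 1 (Nat.le_add_left 1 (i + 1))).isDirection.smul hT _)
        (deriv_smul_chain hT hγ _ 0 1 (i + 1)) ih, show 1 + i + 1 = i + 1 + 1 by ring]
      push_cast
      module
  induction j, hj using Nat.le_induction with
  | base => rw [bracket_swap, base i hi]; module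
  | succ j hj ih =>
    rw [bracket_chain_succ hT hγ 0 1 1 0 hi hj
      ((chain_regular hT hγ 0 1 (Nat.le_add_left 1 (i + j))).isDirection.smul hT _)
      (deriv_smul_chain hT hγ _ 0 1 (i + j)) ih]
    simp [add_assoc]

/-- Each step in the second index subtracts b = 1 from the coefficient, which is 0 for equal
arguments; antisymmetry gives the first index. -/
lemma bracket_masters (hT : IsIndicatrix T) (hγ : ∀ s, HasDerivAt γ (T s) s) {i j : ℕ}
    (hi : 1 ≤ i) (hj : 1 ≤ j) : bracket (chain γ T 1 0 i) (chain γ T 1 0 j) =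
      ((i : ℝ) - j) • (chain γ T 1 0 (i + j)).field := by
  have step : ∀ {i j : ℕ}, 1 ≤ i → 1 ≤ j → bracket (chain γ T 1 0 i) (chain γ T 1 0 j) =
      ((i : ℝ) - j) • (chain γ T 1 0 (i + j)).field →
      bracket (chain γ T 1 0 i) (chain γ T 1 0 (j + 1)) =
      ((i : ℝ) - (j + 1 : ℕ)) • (chain γ T 1 0 (i + (j + 1))).field := by
    intro i j hi hj h
    rw [bracket_chain_succ hT hγ 1 0 1 0 hi hj
      ((chain_regular hT hγ 1 0 (Nat.le_add_left 1 (i + j))).isDirection.smul hT _)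
      (deriv_smul_chain hT hγ _ 1 0 (i + j)) h]
    push_cast
    rw [← add_assoc]
    module
  have base : ∀ i : ℕ, 1 ≤ i → bracket (chain γ T 1 0 1) (chain γ T 1 0 i) =
      (((1 : ℕ) : ℝ) - i) • (chain γ T 1 0 (1 + i)).field := by
    intro i hi
    induction i, hi using Nat.le_induction with
    | base => rw [bracket_self]; simp
    | succ i hi ih => exact step le_rfl hi ih
  induction j, hj using Nat.le_induction with
  | base => rw [bracket_swap, base i hi, add_comm]; module
  | succ j hj ih => exact step hi hj ih

end

/-! ## Growth of functions on the line -/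

section

variable {E : Type*} [NormedAddCommGroup E] [NormedSpace ℝ E]

/-- `f` is `n` times differentiable, with polynomially bounded derivatives. -/
def TemperateOrder : ℕ → (ℝ → E) → Prop
  | 0, f => ∃ (k : ℕ) (C : ℝ), ∀ s, ‖f s‖ ≤ C * (1 + ‖s‖) ^ k
  | n + 1, f => (∃ (k : ℕ) (C : ℝ), ∀ s, ‖f s‖ ≤ C * (1 + ‖s‖) ^ k) ∧ Differentiable ℝ f ∧
      TemperateOrder n (deriv f)

lemma TemperateOrder.pred : ∀ {n : ℕ} {f : ℝ → E}, TemperateOrder (n + 1) f → TemperateOrder n f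
  | 0, _, h => h.1
  | _ + 1, _, h => ⟨h.1, h.2.1, h.2.2.pred⟩

lemma TemperateOrder.add : ∀ {n : ℕ} {f g : ℝ → E}, TemperateOrder n f → TemperateOrder n g →
    TemperateOrder n (fun s => f s + g s) := by
  have base : ∀ {f g : ℝ → E}, TemperateOrder 0 f → TemperateOrder 0 g →
      TemperateOrder 0 (fun s => f s + g s) := by
    rintro f g ⟨k, C, hf⟩ ⟨l, D, hg⟩
    refine ⟨k + l, |C| + |D|, fun s => (norm_add_le _ _).trans ?_⟩
    have h1 : (1 : ℝ) ≤ 1 + ‖s‖ := by simp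
    have h2 : C * (1 + ‖s‖) ^ k ≤ |C| * (1 + ‖s‖) ^ (k + l) :=
      mul_le_mul (le_abs_self C) (pow_le_pow_right₀ h1 (by lia)) (by positivity) (abs_nonneg C)
    have h3 : D * (1 + ‖s‖) ^ l ≤ |D| * (1 + ‖s‖) ^ (k + l) :=
      mul_le_mul (le_abs_self D) (pow_le_pow_right₀ h1 (by lia)) (by positivity) (abs_nonneg D)
    linarith [hf s, hg s]
  intro n
  induction n with
  | zero => exact base
  | succ n ih =>
    intro f g hf hg
    refine ⟨base hf.1 hg.1, hf.2.1.add hg.2.1, ?_⟩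
    rw [show deriv (fun s => f s + g s) = fun s => deriv f s + deriv g s from
      funext fun s => deriv_fun_add (hf.2.1 s) (hg.2.1 s)]
    exact ih hf.2.2 hg.2.2

lemma TemperateOrder.smul : ∀ {n : ℕ} {a : ℝ → ℝ} {f : ℝ → E}, TemperateOrder n a →
    TemperateOrder n f → TemperateOrder n (fun s => a s • f s) := by
  have base : ∀ {a : ℝ → ℝ} {f : ℝ → E}, TemperateOrder 0 a → TemperateOrder 0 f →
      TemperateOrder 0 (fun s => a s • f s) := by
    rintro a f ⟨k, C, ha⟩ ⟨l, D, hf⟩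
    refine ⟨k + l, C * D, fun s => ?_⟩
    rw [norm_smul]
    calc ‖a s‖ * ‖f s‖ ≤ (C * (1 + ‖s‖) ^ k) * (D * (1 + ‖s‖) ^ l) :=
          mul_le_mul (ha s) (hf s) (norm_nonneg _) ((norm_nonneg _).trans (ha s))
      _ = _ := by ring
  intro n
  induction n with
  | zero => exact base
  | succ n ih =>
    intro a f ha hf
    refine ⟨base ha.1 hf.1, ha.2.1.smul hf.2.1, ?_⟩
    rw [show deriv (fun s => a s • f s) = fun s => a s • deriv f s + deriv a s • f s from
      funext fun s => deriv_fun_smul (ha.2.1 s) (hf.2.1 s)]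
    exact (ih ha.pred hf.2.2).add (ih ha.2.2 hf.pred)

lemma _root_.Function.HasTemperateGrowth.temperateOrder : ∀ {n : ℕ} {f : ℝ → E},
    f.HasTemperateGrowth → TemperateOrder n f := by
  have base : ∀ {f : ℝ → E}, f.HasTemperateGrowth → TemperateOrder 0 f := by
    intro f hf
    obtain ⟨k, C, h⟩ := hf.2 0
    exact ⟨k, C, fun s => by simpa using h s⟩
  intro n
  induction n with
  | zero => exact base
  | succ n ih =>
    intro f hf
    exact ⟨base hf, hf.1.differentiable (by simp), ih (temperate_deriv hf)⟩

lemma TemperateOrder.iteratedDeriv : ∀ {n : ℕ} {f : ℝ → E}, TemperateOrder n f →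
    TemperateOrder 0 (iteratedDeriv n f) := by
  intro n
  induction n with
  | zero => intro f h; simpa using h
  | succ n ih => intro f h; rw [iteratedDeriv_succ']; exact ih h.2.2

lemma hasTemperateGrowth_of_temperateOrder {f : ℝ → E} (hf : ContDiff ℝ ∞ f)
    (h : ∀ n, TemperateOrder n f) : f.HasTemperateGrowth := by
  refine ⟨hf, fun n => ?_⟩
  obtain ⟨k, C, hk⟩ := (h n).iteratedDeriv
  exact ⟨k, C, fun s => by rw [norm_iteratedFDeriv_eq_norm_iteratedDeriv]; exact hk s⟩

end

/-! ### Global bounds from the asymptotic conditions -/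

lemma polynomial_abs_eval_le (P : Polynomial ℝ) :
    ∃ (C : ℝ) (k : ℕ), 0 ≤ C ∧ ∀ s : ℝ, |P.eval s| ≤ C * (1 + s ^ 2) ^ k := by
  induction P using Polynomial.induction_on' with
  | add p q hp hq =>
    obtain ⟨C, k, hC, hp⟩ := hp
    obtain ⟨D, l, hD, hq⟩ := hq
    refine ⟨C + D, k + l, by positivity, fun s => ?_⟩
    have h1 : (1 : ℝ) ≤ 1 + s ^ 2 := by nlinarith [sq_nonneg s]
    rw [Polynomial.eval_add]
    have h2 : C * (1 + s ^ 2) ^ k ≤ C * (1 + s ^ 2) ^ (k + l) :=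
      mul_le_mul_of_nonneg_left (pow_le_pow_right₀ h1 (by lia)) hC
    have h3 : D * (1 + s ^ 2) ^ l ≤ D * (1 + s ^ 2) ^ (k + l) :=
      mul_le_mul_of_nonneg_left (pow_le_pow_right₀ h1 (by lia)) hD
    linarith [abs_add_le (p.eval s) (q.eval s), hp s, hq s]
  | monomial n a =>
    refine ⟨|a|, n, abs_nonneg a, fun s => ?_⟩
    rw [Polynomial.eval_monomial, abs_mul, abs_pow]
    refine mul_le_mul_of_nonneg_left (pow_le_pow_left₀ (abs_nonneg s) ?_ n) (abs_nonneg a)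
    nlinarith [sq_nonneg (|s| - 1), sq_abs s, abs_nonneg s]

lemma one_add_sq_pow_eval (k : ℕ) (s : ℝ) :
    (((1 : Polynomial ℝ) + Polynomial.X ^ 2) ^ k).eval s = (1 + s ^ 2) ^ k := by simp

lemma one_add_sq_pow_le (k : ℕ) (s : ℝ) : (1 + s ^ 2) ^ k ≤ (1 + ‖s‖) ^ (2 * k) := by
  rw [pow_mul]
  refine pow_le_pow_left₀ (by positivity) ?_ k
  have : s ^ 2 = ‖s‖ ^ 2 := by simp
  nlinarith [norm_nonneg s]

lemma exists_bound_of_eventually {f : ℝ → ℝ} (hf : Continuous f) {C : ℝ}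
    (h : ∀ᶠ s in atBot ⊔ atTop, |f s| ≤ C) : ∃ D, ∀ s, |f s| ≤ D := by
  rw [← cocompact_eq_atBot_atTop] at h
  obtain ⟨K, hK, hKC⟩ := mem_cocompact.mp h
  obtain ⟨D, hD⟩ := hK.exists_bound_of_continuousOn hf.continuousOn
  refine ⟨max C D, fun s => ?_⟩
  by_cases hs : s ∈ K
  · exact (hD s hs).trans (le_max_right _ _)
  · exact (hKC hs : |f s| ≤ C).trans (le_max_left _ _)

lemma RapidlyDecreasing.exists_bound {f : ℝ → ℝ} (hf : RapidlyDecreasing f) (hc : Continuous f)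
    (P : Polynomial ℝ) : ∃ C, ∀ s, |f s * P.eval s| ≤ C := by
  have h := ((hf P).abs.eventually (gt_mem_nhds (show |(0 : ℝ)| < 1 by simp))).mono fun _ => le_of_lt
  exact exists_bound_of_eventually (hc.mul P.continuous) h

lemma AsympPolynomialLike.exists_bound {f : ℝ → ℝ} (hf : AsympPolynomialLike f)
    (hc : Continuous f) : ∃ (C : ℝ) (k : ℕ), 0 ≤ C ∧ ∀ s, |f s| ≤ C * (1 + s ^ 2) ^ k := by
  obtain ⟨P, hP, h⟩ := hf
  obtain ⟨C, k, hC, hPk⟩ := polynomial_abs_eval_le P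
  have h1 : ∀ᶠ s in atBot ⊔ atTop, |f s / P.eval s| < 1 :=
    h.abs.eventually (gt_mem_nhds (show |(0 : ℝ)| < 1 by simp))
  -- At a root of P the quotient is 0 by convention and carries no information; there are finitely
  -- many roots, so they can be avoided near infinity.
  have h2 : ∀ᶠ s in atBot ⊔ atTop, P.eval s ≠ 0 := by
    rw [← cocompact_eq_atBot_atTop]
    have : {s | P.IsRoot s}.Finite := Polynomial.finite_setOfPred_isRoot hP
    exact this.isCompact.compl_mem_cocompact
  have hpos : ∀ s : ℝ, 0 < (1 + s ^ 2) ^ k := fun s => by positivity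
  have h3 : ∀ᶠ s in atBot ⊔ atTop, |f s / (1 + s ^ 2) ^ k| ≤ C := by
    filter_upwards [h1, h2] with s hs hs'
    rw [abs_div, abs_of_pos (hpos s), div_le_iff₀ (hpos s)]
    rw [abs_div, div_lt_one (abs_pos.mpr hs')] at hs
    exact hs.le.trans (hPk s)
  obtain ⟨D, hD⟩ := exists_bound_of_eventually
    (hc.div (by fun_prop) fun s => (hpos s).ne') h3
  refine ⟨D, k, (abs_nonneg _).trans (hD 0), fun s => ?_⟩
  have := hD s
  rwa [Pi.div_apply, abs_div, abs_of_pos (hpos s), div_le_iff₀ (hpos s)] at this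

/-! ## The Frenet frame -/

lemma norm_cross_eq_one {t n : E3} (ht : ‖t‖ = 1) (hn : ‖n‖ = 1) (htn : inner ℝ t n = (0 : ℝ)) :
    ‖cross t n‖ = 1 := by
  have h : inner ℝ (cross t n) (cross t n) = (1 : ℝ) := by
    rw [inner_cross_perm, cross_cross, inner_sub_right, inner_smul_right, inner_smul_right,
      real_inner_comm t n, htn, inner_self_of_norm_eq_one ht, inner_self_of_norm_eq_one hn]
    norm_num
  rw [real_inner_self_eq_norm_sq] at h
  nlinarith [norm_nonneg (cross t n)]

/-- The part `r` of `w` orthogonal to `t` and `n` has zero product with t × n, hence is a multiple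
of it. -/
lemma frame_expansion {t n : E3} (ht : ‖t‖ = 1) (hn : ‖n‖ = 1) (htn : inner ℝ t n = (0 : ℝ))
    (w : E3) : w = (inner ℝ t w : ℝ) • t + (inner ℝ n w : ℝ) • n
      + (inner ℝ (cross t n) w : ℝ) • cross t n := by
  set r := w - (inner ℝ t w : ℝ) • t - (inner ℝ n w : ℝ) • n with hr
  have h1 : inner ℝ t r = (0 : ℝ) := by
    simp [hr, inner_sub_right, inner_smul_right, htn, ht]
  have h2 : inner ℝ n r = (0 : ℝ) := by
    simp [hr, inner_sub_right, inner_smul_right, real_inner_comm t n, htn, hn]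
  have h3 : cross (cross t n) r = 0 := by
    rw [cross_anticomm, cross_cross, real_inner_comm, h2, real_inner_comm, h1]; simp
  have h4 := eq_smul_of_cross_eq_zero (norm_cross_eq_one ht hn htn) h3
  have h5 : inner ℝ (cross t n) r = (inner ℝ (cross t n) w : ℝ) := by
    rw [hr, inner_sub_right, inner_sub_right, inner_smul_right, inner_smul_right,
      real_inner_comm t, real_inner_comm n, inner_self_cross, inner_cross_self]
    ring
  rw [h5] at h4
  rw [← h4, hr]
  abel

section

variable {γ₀ : ℝ → E3}

namespace BAL

variable (γ : BAL γ₀)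

lemma contDiff_curve : ContDiff ℝ ∞ γ.1 := γ.2.apc.1

lemma hasDerivAt_curve (s : ℝ) : HasDerivAt γ.1 (tangentVec γ.1 s) s :=
  (γ.contDiff_curve.differentiable (by simp) s).hasDerivAt

lemma contDiff_T : ContDiff ℝ ∞ (tangentVec γ.1) := (contDiff_infty_iff_deriv.mp γ.contDiff_curve).2

lemma norm_T (s : ℝ) : ‖tangentVec γ.1 s‖ = 1 := γ.2.apc.2 s

lemma curvature_pos (s : ℝ) : 0 < curvature γ.1 s :=
  lt_of_le_of_ne (norm_nonneg _) (γ.2.curvature_ne_zero s).symm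

lemma contDiff_deriv_T : ContDiff ℝ ∞ (deriv (tangentVec γ.1)) :=
  (contDiff_infty_iff_deriv.mp γ.contDiff_T).2

lemma contDiff_curvature : ContDiff ℝ ∞ (curvature γ.1) :=
  γ.contDiff_deriv_T.norm ℝ fun s => norm_ne_zero_iff.mp (γ.2.curvature_ne_zero s)

lemma contDiff_N : ContDiff ℝ ∞ (normalVec γ.1) :=
  (γ.contDiff_curvature.inv γ.2.curvature_ne_zero).smul γ.contDiff_deriv_T

lemma contDiff_B : ContDiff ℝ ∞ (binormalVec γ.1) :=
  (crossCLM.isBoundedBilinearMap.contDiff).comp₂ γ.contDiff_T γ.contDiff_N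

lemma contDiff_torsion : ContDiff ℝ ∞ (torsion γ.1) :=
  ((contDiff_infty_iff_deriv.mp γ.contDiff_N).2).inner ℝ γ.contDiff_B

lemma deriv_T (s : ℝ) : deriv (tangentVec γ.1) s = curvature γ.1 s • normalVec γ.1 s := by
  rw [normalVec, smul_smul, mul_inv_cancel₀ (γ.2.curvature_ne_zero s), one_smul]

lemma hasDerivAt_T (s : ℝ) :
    HasDerivAt (tangentVec γ.1) (curvature γ.1 s • normalVec γ.1 s) s := by
  rw [← γ.deriv_T]
  exact (γ.contDiff_T.differentiable (by simp) s).hasDerivAt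

lemma norm_N (s : ℝ) : ‖normalVec γ.1 s‖ = 1 := by
  rw [normalVec, norm_smul, norm_inv, Real.norm_of_nonneg (γ.curvature_pos s).le]
  exact inv_mul_cancel₀ (γ.2.curvature_ne_zero s)

lemma inner_T_N (s : ℝ) : inner ℝ (tangentVec γ.1 s) (normalVec γ.1 s) = (0 : ℝ) := by
  have h := (γ.hasDerivAt_T s).inner ℝ (γ.hasDerivAt_T s)
  simp only [inner_self_of_norm_eq_one (γ.norm_T _)] at h
  have h0 := h.unique (hasDerivAt_const s (1 : ℝ))
  rw [real_inner_comm (tangentVec γ.1 s), inner_smul_right] at h0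
  have := γ.2.curvature_ne_zero s
  have h1 : curvature γ.1 s * inner ℝ (tangentVec γ.1 s) (normalVec γ.1 s) = 0 := by linarith
  exact (mul_eq_zero.mp h1).resolve_left this

lemma norm_B (s : ℝ) : ‖binormalVec γ.1 s‖ = 1 :=
  norm_cross_eq_one (γ.norm_T s) (γ.norm_N s) (γ.inner_T_N s)

lemma inner_T_B (s : ℝ) : inner ℝ (tangentVec γ.1 s) (binormalVec γ.1 s) = (0 : ℝ) :=
  inner_self_cross _ _

lemma inner_N_B (s : ℝ) : inner ℝ (normalVec γ.1 s) (binormalVec γ.1 s) = (0 : ℝ) :=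
  inner_cross_self _ _

lemma cross_T_B (s : ℝ) : cross (tangentVec γ.1 s) (binormalVec γ.1 s) = -normalVec γ.1 s := by
  rw [binormalVec, cross_cross, γ.inner_T_N, inner_self_of_norm_eq_one (γ.norm_T s)]
  module

lemma hasDerivAt_N (s : ℝ) : HasDerivAt (normalVec γ.1)
    (-(curvature γ.1 s • tangentVec γ.1 s) + torsion γ.1 s • binormalVec γ.1 s) s := by
  have hN : HasDerivAt (normalVec γ.1) (deriv (normalVec γ.1) s) s :=
    (γ.contDiff_N.differentiable (by simp) s).hasDerivAt
  have h1 : inner ℝ (tangentVec γ.1 s) (deriv (normalVec γ.1) s) = -curvature γ.1 s := by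
    have h := (γ.hasDerivAt_T s).inner ℝ hN
    simp only [γ.inner_T_N] at h
    have h0 := h.unique (hasDerivAt_const s (0 : ℝ))
    rw [inner_smul_left, inner_self_of_norm_eq_one (γ.norm_N s)] at h0
    simp only [conj_trivial] at h0
    linarith
  have h2 : inner ℝ (normalVec γ.1 s) (deriv (normalVec γ.1) s) = (0 : ℝ) := by
    have h := hN.inner ℝ hN
    simp only [inner_self_of_norm_eq_one (γ.norm_N _)] at h
    have h0 := h.unique (hasDerivAt_const s (1 : ℝ))
    rw [real_inner_comm (normalVec γ.1 s)] at h0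
    linarith
  have h3 := frame_expansion (γ.norm_T s) (γ.norm_N s) (γ.inner_T_N s) (deriv (normalVec γ.1) s)
  rw [h1, h2, real_inner_comm (deriv (normalVec γ.1) s)] at h3
  refine hN.congr_deriv (h3.trans ?_)
  rw [torsion, binormalVec]
  module

lemma hasDerivAt_B (s : ℝ) : HasDerivAt (binormalVec γ.1)
    (-(torsion γ.1 s • normalVec γ.1 s)) s := by
  refine (hasDerivAt_cross (γ.hasDerivAt_T s) (γ.hasDerivAt_N s)).congr_deriv ?_
  rw [smul_cross, cross_self, cross_add, cross_neg, cross_smul, cross_smul, cross_self,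
    γ.cross_T_B]
  module

/-! ### Decay of the curvature, growth of the torsion and of the frame -/

/-- The n-th derivative is κ times a function of polynomial growth, and κ decreases faster than any
power. -/
lemma sch_curvature : IsSch (curvature γ.1) := by
  refine ⟨⟨curvature γ.1, γ.contDiff_curvature, fun m n => ?_⟩, rfl⟩
  obtain ⟨C, k, hC, hb⟩ := (γ.2.curvature_deriv n).exists_bound
    ((γ.contDiff_curvature.continuous.inv₀ γ.2.curvature_ne_zero).mul
      (γ.contDiff_curvature.continuous_iteratedDeriv n (by exact_mod_cast le_top)))
  obtain ⟨D, hD⟩ := γ.2.curvature_decay.exists_bound γ.contDiff_curvature.continuous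
    ((1 + Polynomial.X ^ 2) ^ (m + k))
  refine ⟨C * D, fun s => ?_⟩
  have h1 := hb s
  have h2 := hD s
  have hκ := γ.curvature_pos s
  have hw : (0 : ℝ) < 1 + s ^ 2 := by positivity
  rw [one_add_sq_pow_eval, abs_mul, abs_of_pos hκ, abs_of_pos (pow_pos hw _)] at h2
  rw [abs_mul, abs_of_pos (inv_pos.mpr hκ), inv_mul_le_iff₀ hκ] at h1
  rw [norm_iteratedFDeriv_eq_norm_iteratedDeriv, Real.norm_eq_abs, Real.norm_eq_abs]
  have h3 : |s| ^ m ≤ (1 + s ^ 2) ^ m :=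
    pow_le_pow_left₀ (abs_nonneg s) (by nlinarith [sq_nonneg (|s| - 1), sq_abs s]) m
  calc |s| ^ m * |iteratedDeriv n (curvature γ.1) s|
      ≤ (1 + s ^ 2) ^ m * (curvature γ.1 s * (C * (1 + s ^ 2) ^ k)) :=
        mul_le_mul h3 h1 (abs_nonneg _) (by positivity)
    _ = C * (curvature γ.1 s * (1 + s ^ 2) ^ (m + k)) := by ring
    _ ≤ C * D := mul_le_mul_of_nonneg_left h2 hC

lemma temperate_torsion : (torsion γ.1).HasTemperateGrowth := by
  refine ⟨γ.contDiff_torsion, fun n => ?_⟩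
  obtain ⟨C, k, hC, hb⟩ := (γ.2.torsion_deriv n).exists_bound
    (γ.contDiff_torsion.continuous_iteratedDeriv n (by exact_mod_cast le_top))
  refine ⟨2 * k, C, fun s => ?_⟩
  rw [norm_iteratedFDeriv_eq_norm_iteratedDeriv, Real.norm_eq_abs]
  exact (hb s).trans (mul_le_mul_of_nonneg_left (one_add_sq_pow_le k s) hC)

/-- The Frenet equations couple the three vectors, so the order is raised for all three at once: one
derivative costs a temperate factor κ or τ and frame vectors of the previous order. -/
lemma temperateOrder_frame (n : ℕ) : TemperateOrder n (tangentVec γ.1) ∧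
    TemperateOrder n (normalVec γ.1) ∧ TemperateOrder n (binormalVec γ.1) := by
  have hT0 : TemperateOrder 0 (tangentVec γ.1) := ⟨0, 1, fun s => by simp [γ.norm_T s]⟩
  have hN0 : TemperateOrder 0 (normalVec γ.1) := ⟨0, 1, fun s => by simp [γ.norm_N s]⟩
  have hB0 : TemperateOrder 0 (binormalVec γ.1) := ⟨0, 1, fun s => by simp [γ.norm_B s]⟩
  induction n with
  | zero => exact ⟨hT0, hN0, hB0⟩
  | succ n ih =>
    have hκ := γ.sch_curvature.hasTemperateGrowth
    have hτ := γ.temperate_torsion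
    refine ⟨⟨hT0, fun s => (γ.hasDerivAt_T s).differentiableAt, ?_⟩,
      ⟨hN0, fun s => (γ.hasDerivAt_N s).differentiableAt, ?_⟩,
      ⟨hB0, fun s => (γ.hasDerivAt_B s).differentiableAt, ?_⟩⟩
    · rw [show deriv (tangentVec γ.1) = _ from funext fun s => (γ.hasDerivAt_T s).deriv]
      exact hκ.temperateOrder.smul ih.2.1
    · rw [show deriv (normalVec γ.1) = _ from funext fun s => (γ.hasDerivAt_N s).deriv]
      simp only [← neg_smul]
      exact (hκ.neg.temperateOrder.smul ih.1).add (hτ.temperateOrder.smul ih.2.2)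
    · rw [show deriv (binormalVec γ.1) = _ from funext fun s => (γ.hasDerivAt_B s).deriv]
      simp only [← neg_smul]
      exact hτ.neg.temperateOrder.smul ih.2.1

lemma temperate_T : (tangentVec γ.1).HasTemperateGrowth :=
  hasTemperateGrowth_of_temperateOrder γ.contDiff_T fun n => (γ.temperateOrder_frame n).1

lemma temperate_N : (normalVec γ.1).HasTemperateGrowth :=
  hasTemperateGrowth_of_temperateOrder γ.contDiff_N fun n => (γ.temperateOrder_frame n).2.1

lemma temperate_B : (binormalVec γ.1).HasTemperateGrowth :=
  hasTemperateGrowth_of_temperateOrder γ.contDiff_B fun n => (γ.temperateOrder_frame n).2.2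

lemma isIndicatrix : IsIndicatrix (tangentVec γ.1) where
  norm_one := γ.norm_T
  temperate := γ.temperate_T
  sch := by
    rw [show deriv (tangentVec γ.1) = _ from funext γ.deriv_T]
    exact γ.sch_curvature.smul_temperate γ.temperate_N

end BAL

/-! ## The recursion operator in terms of tangent fields -/

/-- Fields with coefficients in the Schwartz class along every curve. -/
def SchField (X : NormalField γ₀) : Prop := ∀ γ, IsSch (X.1 γ) ∧ IsSch (X.2 γ)

lemma SchField.density {X : NormalField γ₀} (hX : SchField X) (γ : BAL γ₀) :
    IsSch (fun t => curvature γ.1 t * X.1 γ t) :=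
  γ.sch_curvature.smul_temperate (hX γ).1.hasTemperateGrowth

lemma lift_apply (X : NormalField γ₀) (γ : BAL γ₀) (s : ℝ) : lift X γ s =
    antiD (fun t => curvature γ.1 t * X.1 γ t) s • tangentVec γ.1 s + X.1 γ s • normalVec γ.1 s
      + X.2 γ s • binormalVec γ.1 s := rfl

/-- The T-component cancels: the derivative κg of the antiderivative meets -κg from the Frenet
equation for N. -/
lemma hasDerivAt_lift {X : NormalField γ₀} (hX : SchField X) (γ : BAL γ₀) (s : ℝ) :
    HasDerivAt (lift X γ)
      ((curvature γ.1 s * antiD (fun t => curvature γ.1 t * X.1 γ t) s + deriv (X.1 γ) s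
        - torsion γ.1 s * X.2 γ s) • normalVec γ.1 s
        + (deriv (X.2 γ) s + torsion γ.1 s * X.1 γ s) • binormalVec γ.1 s) s := by
  have h := ((((hX.density γ).hasDerivAt_antiD s).smul (γ.hasDerivAt_T s)).add
    (((hX γ).1.differentiable s).hasDerivAt.smul (γ.hasDerivAt_N s))).add
    (((hX γ).2.differentiable s).hasDerivAt.smul (γ.hasDerivAt_B s))
  refine h.congr_deriv ?_
  module

lemma isDirection_lift {X : NormalField γ₀} (hX : SchField X) (γ : BAL γ₀) :
    IsDirection (tangentVec γ.1) (lift X γ) where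
  balanced := by
    refine ⟨_, _, ((hX γ).1.smul_temperate γ.temperate_N).add
      ((hX γ).2.smul_temperate γ.temperate_B), hX.density γ, ?_⟩
    ext1 s
    rw [lift_apply]
    abel
  perp s := by
    rw [(hasDerivAt_lift hX γ s).deriv, inner_add_right, inner_smul_right, inner_smul_right,
      γ.inner_T_N, γ.inner_T_B]
    ring

/-- Written with sums, products and real multiples only, so that both degree in `Alg` and tameness
along a variation can be read off. -/
lemma recOp_eq {X : NormalField γ₀} (hX : SchField X) :
    recOp X = (dS X.2 + tau * X.1,
      (-1 : ℝ) • (kappa * antiS (kappa * X.1) + (dS X.1 + (-1 : ℝ) • (tau * X.2)))) := by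
  have hd : ∀ γ s, nablaS (lift X) γ s = _ := fun γ s => (hasDerivAt_lift hX γ s).deriv
  have hNN : ∀ (γ : BAL γ₀) s, inner ℝ (normalVec γ.1 s) (normalVec γ.1 s) = (1 : ℝ) :=
    fun γ s => inner_self_of_norm_eq_one (γ.norm_N s)
  have hBB : ∀ (γ : BAL γ₀) s, inner ℝ (binormalVec γ.1 s) (binormalVec γ.1 s) = (1 : ℝ) :=
    fun γ s => inner_self_of_norm_eq_one (γ.norm_B s)
  refine Prod.ext ?_ ?_
  · ext γ s
    simp only [recOp, opJ, proj, hd, fieldB, inner_add_right, inner_smul_right, hBB,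
      real_inner_comm (normalVec γ.1 s), γ.inner_N_B]
    simp [dS, tau]
  · ext γ s
    simp only [recOp, opJ, proj, hd, fieldN, inner_add_right, inner_smul_right, hNN,
      γ.inner_N_B, Pi.neg_apply]
    simp only [antiS, antiD, kappa, tau, dS, Pi.smul_apply, Pi.add_apply, Pi.mul_apply,
      smul_eq_mul]
    ring

lemma SchField.recOp {X : NormalField γ₀} (hX : SchField X) : SchField (recOp X) := by
  intro γ
  have hV := (isDirection_lift hX γ).sch γ.isIndicatrix
  exact ⟨hV.temperate_inner γ.temperate_B, (hV.temperate_inner γ.temperate_N).neg⟩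

/-- From T' = κN and T × N = B the density is κ⟨B, V'⟩, and J makes ⟨B, V'⟩ the N-coefficient of the
next field. -/
lemma tangentialDensity_lift (X : NormalField γ₀) (γ : BAL γ₀) :
    tangentialDensity (tangentVec γ.1) (lift X γ) =
      fun t => curvature γ.1 t * (recOp X).1 γ t := by
  ext1 t
  rw [tangentialDensity, γ.deriv_T, smul_cross, inner_smul_right, inner_cross_perm,
    inner_cross_perm, real_inner_comm]
  rfl

/-- On the normal plane J is -T ×, and the tangential parts agree by `tangentialDensity_lift`. Along
a curve the recursion thus is `nextField`. -/
lemma lift_recOp {X : NormalField γ₀} (hX : SchField X) (γ : BAL γ₀) :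
    lift (recOp X) γ = nextField (tangentVec γ.1) (lift X γ) := by
  ext1 s
  have h := frame_expansion (γ.norm_T s) (γ.norm_N s) (γ.inner_T_N s) (deriv (lift X γ) s)
  rw [(isDirection_lift hX γ).perp, zero_smul, zero_add] at h
  have h2 : cross (tangentVec γ.1 s) (deriv (lift X γ) s) =
      (inner ℝ (normalVec γ.1 s) (deriv (lift X γ) s) : ℝ) • binormalVec γ.1 s
      - (inner ℝ (binormalVec γ.1 s) (deriv (lift X γ) s) : ℝ) • normalVec γ.1 s := by
    conv_lhs => rw [h]
    change cross (tangentVec γ.1 s) (_ + (inner ℝ (binormalVec γ.1 s) _ : ℝ) • binormalVec γ.1 s) = _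
    rw [cross_add, cross_smul, cross_smul, γ.cross_T_B, ← binormalVec]
    module
  rw [lift_apply, ← tangentialDensity_lift, nextField, h2]
  change _ + (inner ℝ (binormalVec γ.1 s) (deriv (lift X γ) s) : ℝ) • normalVec γ.1 s
    + (-(inner ℝ (normalVec γ.1 s) (deriv (lift X γ) s) : ℝ)) • binormalVec γ.1 s = _
  module

lemma recOp_mem {X : NormalField γ₀} (hX : SchField X) (h : X ∈ vectorFields γ₀) :
    recOp X ∈ vectorFields γ₀ := by
  obtain ⟨h1, h2⟩ := h
  rw [recOp_eq hX]
  refine ⟨h2.dS.add (by simpa using Alg.tau.mul h1), Alg.smul _ (Alg.add ?_ (h1.dS.add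
    (Alg.smul _ (by simpa using Alg.tau.mul h2))))⟩
  -- Here degree 1 of the coefficients matters: with the factor κ the integrand has degree 2, as
  -- ∂ₛ⁻¹ demands, and the outer κ restores degree 1.
  have h3 : Alg 2 (kappa * X.1) := Alg.kappa.mul h1
  simpa using Alg.kappa.mul h3.antiS

/-! ### The two hierarchies as fields on the space of curves -/

lemma schField_affine (b c : ℝ) :
    SchField (γ₀ := γ₀) (0, (b • param + c • 1) * kappa) := by
  intro γ
  refine ⟨IsSch.zero, ?_⟩
  have h := γ.sch_curvature.temperate_smul (temperate_affine b c)
  convert h using 1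
  ext1 s
  simp [param, kappa]

lemma affine_mem (b c : ℝ) :
    ((0, (b • param + c • 1) * kappa) : NormalField γ₀) ∈ vectorFields γ₀ := by
  refine ⟨(zero_mem (vectorFields γ₀)).1, ?_⟩
  simpa using ((Alg.param.smul b).add (Alg.one.smul c)).mul Alg.kappa

variable (γ₀) in
/-- The hierarchy of fields generated by `(b s + c) κ B`. -/
def hierarchy (b c : ℝ) (n : ℕ) : NormalField γ₀ := recOp^[n] (0, (b • param + c • 1) * kappa)

lemma hierarchy_succ (b c : ℝ) (n : ℕ) :
    hierarchy γ₀ b c (n + 1) = recOp (hierarchy γ₀ b c n) :=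
  Function.iterate_succ_apply' _ _ _

lemma schField_hierarchy (b c : ℝ) (n : ℕ) : SchField (hierarchy γ₀ b c n) := by
  induction n with
  | zero => exact schField_affine b c
  | succ n ih => rw [hierarchy_succ]; exact ih.recOp

lemma hierarchy_mem (b c : ℝ) (n : ℕ) : hierarchy γ₀ b c n ∈ vectorFields γ₀ := by
  induction n with
  | zero => exact affine_mem b c
  | succ n ih => rw [hierarchy_succ]; exact recOp_mem (schField_hierarchy b c n) ih

lemma symX_eq (n : ℕ) : symX γ₀ n = hierarchy γ₀ 0 1 n := by
  simp [symX, hierarchy]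

lemma masterY_eq (n : ℕ) : masterY γ₀ n = hierarchy γ₀ 1 0 (n - 1) := by
  simp [masterY, hierarchy]

/-- The jets along `γ` of the fields of a hierarchy. -/
def BAL.chain (γ : BAL γ₀) (b c : ℝ) (n : ℕ) : Jet :=
  VortexFilament.chain γ.1 (tangentVec γ.1) b c n

lemma lift_hierarchy_zero (b c : ℝ) (γ : BAL γ₀) : lift (hierarchy γ₀ b c 0) γ =
    fun s => (b * s + c) • (curvature γ.1 s • binormalVec γ.1 s) := by
  ext1 s
  have h : (fun t => curvature γ.1 t * (hierarchy γ₀ b c 0).1 γ t) = fun _ => 0 := by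
    ext1 t; simp [hierarchy]
  rw [lift_apply, h, antiD_zero]
  simp [hierarchy, param, kappa, smul_smul]

lemma curvature_smul_B (γ : BAL γ₀) (s : ℝ) : curvature γ.1 s • binormalVec γ.1 s =
    cross (tangentVec γ.1 s) (deriv (tangentVec γ.1) s) := by
  rw [γ.deriv_T, cross_smul, binormalVec]

/-- The shift by one comes from starting the chain of jets a step before (bs + c)κB. -/
lemma lift_hierarchy (b c : ℝ) (n : ℕ) (γ : BAL γ₀) :
    lift (hierarchy γ₀ b c n) γ = (γ.chain b c (n + 1)).field := by
  induction n with
  | zero =>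
    rw [lift_hierarchy_zero]
    simp only [curvature_smul_B]
    exact (chain_one_field γ.isIndicatrix γ.hasDerivAt_curve b c).symm
  | succ n ih =>
    rw [hierarchy_succ, lift_recOp (schField_hierarchy b c n), ih]
    rfl

lemma proj_lift (X : NormalField γ₀) : proj (lift X) = X := by
  refine Prod.ext ?_ ?_ <;> ext γ s <;>
    simp only [proj, lift_apply, fieldN, fieldB, inner_add_right, inner_smul_right,
      real_inner_comm (tangentVec γ.1 s), γ.inner_T_N, γ.inner_T_B, γ.inner_N_B,
      real_inner_comm (normalVec γ.1 s), inner_self_of_norm_eq_one (γ.norm_N s),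
      inner_self_of_norm_eq_one (γ.norm_B s)] <;>
    ring

end

/-! ## Jointly smooth families -/

section Joint

variable {E : Type*} [NormedAddCommGroup E] [NormedSpace ℝ E]

/-- A family of functions on the line that is smooth in the parameter and the variable. -/
def JointSmooth (F : ℝ → ℝ → E) : Prop := ContDiff ℝ ∞ fun q : ℝ × ℝ => F q.1 q.2

variable {F : ℝ → ℝ → E}

lemma JointSmooth.differentiable (hF : JointSmooth F) :
    Differentiable ℝ fun q : ℝ × ℝ => F q.1 q.2 :=
  ContDiff.differentiable hF (by simp)

lemma JointSmooth.hasDerivAt_snd (hF : JointSmooth F) (ε s : ℝ) :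
    HasDerivAt (F ε) (fderiv ℝ (fun q : ℝ × ℝ => F q.1 q.2) (ε, s) (0, 1)) s := by
  have h := (hF.differentiable (ε, s)).hasFDerivAt.comp_hasDerivAt s
    ((hasDerivAt_const s ε).prodMk (hasDerivAt_id s))
  exact h

lemma JointSmooth.hasDerivAt_fst (hF : JointSmooth F) (ε s : ℝ) :
    HasDerivAt (fun e => F e s) (fderiv ℝ (fun q : ℝ × ℝ => F q.1 q.2) (ε, s) (1, 0)) ε := by
  have h := (hF.differentiable (ε, s)).hasFDerivAt.comp_hasDerivAt ε
    ((hasDerivAt_id ε).prodMk (hasDerivAt_const ε s))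
  exact h

lemma JointSmooth.contDiff_fderiv (hF : JointSmooth F) (v : ℝ × ℝ) :
    ContDiff ℝ ∞ fun q : ℝ × ℝ => fderiv ℝ (fun q : ℝ × ℝ => F q.1 q.2) q v :=
  (ContDiff.fderiv_right hF (m := ∞) (by simp)).clm_apply contDiff_const

lemma JointSmooth.deriv_snd (hF : JointSmooth F) : JointSmooth fun ε s => deriv (F ε) s := by
  have h : (fun q : ℝ × ℝ => deriv (F q.1) q.2) = _ :=
    funext fun q => (hF.hasDerivAt_snd q.1 q.2).deriv
  rw [JointSmooth, h]
  exact hF.contDiff_fderiv _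

lemma JointSmooth.deriv_fst (hF : JointSmooth F) :
    JointSmooth fun ε s => deriv (fun e => F e s) ε := by
  have h : (fun q : ℝ × ℝ => deriv (fun e => F e q.2) q.1) = _ :=
    funext fun q => (hF.hasDerivAt_fst q.1 q.2).deriv
  rw [JointSmooth, h]
  exact hF.contDiff_fderiv _

lemma JointSmooth.hasDerivAt_snd' (hF : JointSmooth F) (ε s : ℝ) :
    HasDerivAt (F ε) (deriv (F ε) s) s := (hF.hasDerivAt_snd ε s).differentiableAt.hasDerivAt

lemma JointSmooth.hasDerivAt_fst' (hF : JointSmooth F) (ε s : ℝ) :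
    HasDerivAt (fun e => F e s) (deriv (fun e => F e s) ε) ε :=
  (hF.hasDerivAt_fst ε s).differentiableAt.hasDerivAt

lemma JointSmooth.hasDerivAt_fderiv_apply (hF : JointSmooth F) (v w : ℝ × ℝ) {c : ℝ → ℝ × ℝ}
    {t : ℝ} (hc : HasDerivAt c w t) :
    HasDerivAt (fun r => fderiv ℝ (fun q : ℝ × ℝ => F q.1 q.2) (c r) v)
      (fderiv ℝ (fderiv ℝ fun q : ℝ × ℝ => F q.1 q.2) (c t) w v) t := by
  have hF' : DifferentiableAt ℝ (fderiv ℝ fun q : ℝ × ℝ => F q.1 q.2) (c t) :=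
    (ContDiff.fderiv_right hF (m := ∞) (by simp)).differentiable (by simp) _
  exact ((ContinuousLinearMap.apply ℝ E v).hasFDerivAt.comp (c t)
    hF'.hasFDerivAt).comp_hasDerivAt t hc

lemma JointSmooth.deriv_comm (hF : JointSmooth F) (ε s : ℝ) :
    deriv (fun t => deriv (fun e => F e t) ε) s = deriv (fun e => deriv (F e) s) ε := by
  have hF' : DifferentiableAt ℝ (fderiv ℝ fun q : ℝ × ℝ => F q.1 q.2) (ε, s) :=
    (ContDiff.fderiv_right hF (m := ∞) (by simp)).differentiable (by simp) _
  have hsymm := second_derivative_symmetric (fun y => (hF.differentiable y).hasFDerivAt)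
    hF'.hasFDerivAt (0, 1) (1, 0)
  rw [show (fun t => deriv (fun e => F e t) ε) = _ from
      funext fun t => (hF.hasDerivAt_fst ε t).deriv,
    show (fun e => deriv (F e) s) = _ from funext fun e => (hF.hasDerivAt_snd e s).deriv,
    (hF.hasDerivAt_fderiv_apply (1, 0) (0, 1)
      ((hasDerivAt_const s ε).prodMk (hasDerivAt_id' s))).deriv,
    (hF.hasDerivAt_fderiv_apply (0, 1) (1, 0)
      ((hasDerivAt_id' ε).prodMk (hasDerivAt_const ε s))).deriv]
  exact hsymm

lemma JointSmooth.iteratedDeriv (hF : JointSmooth F) (n : ℕ) :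
    JointSmooth fun ε s => iteratedDeriv n (F ε) s := by
  induction n with
  | zero => simpa using hF
  | succ n ih =>
    simp only [iteratedDeriv_succ]
    exact ih.deriv_snd

end Joint

/-! ## Uniformly controlled families of functions -/

/-- Rapid decrease, uniformly in the parameter. -/
def RapidOn (δ : ℝ) (u : ℝ → ℝ → ℝ) : Prop :=
  ∀ k : ℕ, ∃ C, ∀ ε, |ε| < δ → ∀ s, |u ε s| * (1 + s ^ 2) ^ k ≤ C

/-- Polynomial growth, uniformly in the parameter. -/
def SlowOn (δ : ℝ) (u : ℝ → ℝ → ℝ) : Prop :=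
  ∃ (C : ℝ) (k : ℕ), 0 ≤ C ∧ ∀ ε, |ε| < δ → ∀ s, |u ε s| ≤ C * (1 + s ^ 2) ^ k

/-- `RapidOn` or `SlowOn`, according to a flag. -/
def ControlledOn (δ : ℝ) : Bool → (ℝ → ℝ → ℝ) → Prop
  | true => RapidOn δ
  | false => SlowOn δ

section Controlled

variable {δ : ℝ} {u v : ℝ → ℝ → ℝ}

lemma one_le_weight (s : ℝ) (k : ℕ) : (1 : ℝ) ≤ (1 + s ^ 2) ^ k :=
  one_le_pow₀ (by nlinarith [sq_nonneg s])

lemma SlowOn.add (hu : SlowOn δ u) (hv : SlowOn δ v) : SlowOn δ (fun ε s => u ε s + v ε s) := by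
  obtain ⟨C, k, hC, hu⟩ := hu
  obtain ⟨D, l, hD, hv⟩ := hv
  refine ⟨C + D, k + l, by positivity, fun ε hε s => (abs_add_le _ _).trans ?_⟩
  have h1 : (1 : ℝ) ≤ 1 + s ^ 2 := by nlinarith [sq_nonneg s]
  have h2 : C * (1 + s ^ 2) ^ k ≤ C * (1 + s ^ 2) ^ (k + l) :=
    mul_le_mul_of_nonneg_left (pow_le_pow_right₀ h1 (by lia)) hC
  have h3 : D * (1 + s ^ 2) ^ l ≤ D * (1 + s ^ 2) ^ (k + l) :=
    mul_le_mul_of_nonneg_left (pow_le_pow_right₀ h1 (by lia)) hD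
  linarith [hu ε hε s, hv ε hε s]

lemma RapidOn.add (hu : RapidOn δ u) (hv : RapidOn δ v) :
    RapidOn δ (fun ε s => u ε s + v ε s) := by
  intro k
  obtain ⟨C, hu⟩ := hu k
  obtain ⟨D, hv⟩ := hv k
  refine ⟨C + D, fun ε hε s => ?_⟩
  have := mul_le_mul_of_nonneg_right (abs_add_le (u ε s) (v ε s))
    (zero_le_one.trans (one_le_weight s k))
  linarith [hu ε hε s, hv ε hε s]

lemma SlowOn.mul (hu : SlowOn δ u) (hv : SlowOn δ v) : SlowOn δ (fun ε s => u ε s * v ε s) := by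
  obtain ⟨C, k, hC, hu⟩ := hu
  obtain ⟨D, l, hD, hv⟩ := hv
  refine ⟨C * D, k + l, by positivity, fun ε hε s => ?_⟩
  rw [abs_mul]
  calc |u ε s| * |v ε s| ≤ (C * (1 + s ^ 2) ^ k) * (D * (1 + s ^ 2) ^ l) :=
        mul_le_mul (hu ε hε s) (hv ε hε s) (abs_nonneg _) (by positivity)
    _ = _ := by ring

lemma RapidOn.mul_slow (hu : RapidOn δ u) (hv : SlowOn δ v) :
    RapidOn δ (fun ε s => u ε s * v ε s) := by
  intro k
  obtain ⟨D, l, hD, hv⟩ := hv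
  obtain ⟨C, hu⟩ := hu (k + l)
  refine ⟨C * D, fun ε hε s => ?_⟩
  rw [abs_mul]
  calc |u ε s| * |v ε s| * (1 + s ^ 2) ^ k
      ≤ |u ε s| * (D * (1 + s ^ 2) ^ l) * (1 + s ^ 2) ^ k := by
        gcongr
        exact hv ε hε s
    _ = (|u ε s| * (1 + s ^ 2) ^ (k + l)) * D := by ring
    _ ≤ C * D := mul_le_mul_of_nonneg_right (hu ε hε s) hD

lemma RapidOn.slow (hu : RapidOn δ u) : SlowOn δ u := by
  obtain ⟨C, hu⟩ := hu 0
  refine ⟨|C|, 0, abs_nonneg C, fun ε hε s => ?_⟩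
  have := hu ε hε s
  simp only [pow_zero, mul_one] at this ⊢
  exact this.trans (le_abs_self C)

lemma ControlledOn.add : ∀ {d : Bool}, ControlledOn δ d u → ControlledOn δ d v →
    ControlledOn δ d (fun ε s => u ε s + v ε s)
  | true => RapidOn.add
  | false => SlowOn.add

lemma ControlledOn.mul : ∀ {d : Bool}, ControlledOn δ d u → ControlledOn δ false v →
    ControlledOn δ d (fun ε s => u ε s * v ε s)
  | true => RapidOn.mul_slow
  | false => SlowOn.mul

lemma ControlledOn.slow : ∀ {d : Bool}, ControlledOn δ d u → ControlledOn δ false u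
  | true => RapidOn.slow
  | false => id

lemma ControlledOn.congr (h : ∀ ε, |ε| < δ → u ε = v ε) :
    ∀ {d : Bool}, ControlledOn δ d u → ControlledOn δ d v
  | true => fun hu k => by
      obtain ⟨C, hC⟩ := hu k
      exact ⟨C, fun ε hε s => h ε hε ▸ hC ε hε s⟩
  | false => fun hu => by
      obtain ⟨C, k, hC, hb⟩ := hu
      exact ⟨C, k, hC, fun ε hε s => h ε hε ▸ hb ε hε s⟩

lemma RapidOn.exists_integrable_bound (hu : RapidOn δ u) :
    ∃ b : ℝ → ℝ, Integrable b ∧ ∀ ε, |ε| < δ → ∀ s, |u ε s| ≤ b s := by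
  obtain ⟨C, hC⟩ := hu 1
  refine ⟨fun s => C * (1 + s ^ 2)⁻¹, integrable_inv_one_add_sq.const_mul C, fun ε hε s => ?_⟩
  change _ ≤ C * (1 + s ^ 2)⁻¹
  rw [← div_eq_mul_inv, le_div_iff₀ (by positivity)]
  simpa using hC ε hε s

lemma RapidOn.integrable (hu : RapidOn δ u) {ε : ℝ} (hε : |ε| < δ) (hc : Continuous (u ε)) :
    Integrable (u ε) := by
  obtain ⟨b, hb, h⟩ := hu.exists_integrable_bound
  exact hb.mono' hc.aestronglyMeasurable (ae_of_all _ fun s => h ε hε s)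

lemma RapidOn.antiD (hu : RapidOn δ u) (hc : ∀ ε, |ε| < δ → Continuous (u ε)) :
    SlowOn δ (fun ε => antiD (u ε)) := by
  obtain ⟨b, hb, h⟩ := hu.exists_integrable_bound
  refine ⟨|∫ t, b t|, 0, abs_nonneg _, fun ε hε s => ?_⟩
  have hi := hu.integrable hε (hc ε hε)
  rw [pow_zero, mul_one]
  exact (abs_antiD_le _ hi s).trans ((integral_mono hi.abs hb (h ε hε)).trans (le_abs_self _))

lemma eventually_abs_lt {ε : ℝ} (hε : |ε| < δ) : ∀ᶠ e in 𝓝 ε, |e| < δ :=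
  (continuous_abs.tendsto ε).eventually (gt_mem_nhds hε)

/-- Differentiation under the integral on each half-line separately, dominated by a bound on the
ε-derivative that is uniform for |ε| < δ. -/
lemma hasDerivAt_antiD_family (hu : RapidOn δ u) (hv : RapidOn δ v)
    (huc : ∀ ε, |ε| < δ → Continuous (u ε)) (hvc : ∀ ε, |ε| < δ → Continuous (v ε))
    (h : ∀ ε, |ε| < δ → ∀ s, HasDerivAt (fun e => u e s) (v ε s) ε) {ε : ℝ} (hε : |ε| < δ)
    (s : ℝ) : HasDerivAt (fun e => antiD (u e) s) (antiD (v ε) s) ε := by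
  obtain ⟨b, hb, hvb⟩ := hv.exists_integrable_bound
  have key : ∀ A : Set ℝ, HasDerivAt (fun e => ∫ t in A, u e t) (∫ t in A, v ε t) ε := fun A =>
    (hasDerivAt_integral_of_dominated_loc_of_deriv_le (μ := volume.restrict A)
      (s := {e | |e| < δ}) (eventually_abs_lt hε)
      ((eventually_abs_lt hε).mono fun e he => (huc e he).aestronglyMeasurable)
      (hu.integrable hε (huc ε hε)).integrableOn (hvc ε hε).aestronglyMeasurable
      (ae_of_all _ fun t e he => hvb e he t) hb.integrableOn
      (ae_of_all _ fun t e he => h e he t)).2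
  exact ((key (Set.Iic s)).sub (key (Set.Ioi s))).const_mul (1 / 2)

end Controlled

/-- The families of functions generated by `κ`, `τ` and the variable, together with their
derivatives with respect to the parameter. The flag records rapid decrease. -/
inductive Tame (δ : ℝ) (κ τ : ℝ → ℝ → ℝ) : Bool → (ℝ → ℝ → ℝ) → (ℝ → ℝ → ℝ) → Prop
  | kappa (n : ℕ) : Tame δ κ τ true (fun ε s => iteratedDeriv n (κ ε) s)
      (fun ε s => deriv (fun e => iteratedDeriv n (κ e) s) ε)
  | tau (n : ℕ) : Tame δ κ τ false (fun ε s => iteratedDeriv n (τ ε) s)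
      (fun ε s => deriv (fun e => iteratedDeriv n (τ e) s) ε)
  | param : Tame δ κ τ false (fun _ s => s) (fun _ _ => 0)
  | const (c : ℝ) : Tame δ κ τ false (fun _ _ => c) (fun _ _ => 0)
  | add {d : Bool} {u v u₁ v₁ : ℝ → ℝ → ℝ} : Tame δ κ τ d u v → Tame δ κ τ d u₁ v₁ →
      Tame δ κ τ d (fun ε s => u ε s + u₁ ε s) (fun ε s => v ε s + v₁ ε s)
  | mul {d : Bool} {u v u₁ v₁ : ℝ → ℝ → ℝ} : Tame δ κ τ d u v → Tame δ κ τ false u₁ v₁ →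
      Tame δ κ τ d (fun ε s => u ε s * u₁ ε s) (fun ε s => v ε s * u₁ ε s + u ε s * v₁ ε s)
  | slow {u v : ℝ → ℝ → ℝ} : Tame δ κ τ true u v → Tame δ κ τ false u v
  | antiD {u v : ℝ → ℝ → ℝ} : Tame δ κ τ true u v →
      Tame δ κ τ false (fun ε => antiD (u ε)) (fun ε => antiD (v ε))
  | congr {d : Bool} {u v u₁ : ℝ → ℝ → ℝ} : Tame δ κ τ d u v → (∀ ε, |ε| < δ → u ε = u₁ ε) →
      Tame δ κ τ d u₁ v

/-- Curvature and torsion of a variation, controlled uniformly in the parameter. -/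
structure UniformControl (δ : ℝ) (κ τ : ℝ → ℝ → ℝ) : Prop where
  smooth_kappa : JointSmooth κ
  smooth_tau : JointSmooth τ
  kappa (n : ℕ) : RapidOn δ fun ε s => iteratedDeriv n (κ ε) s
  kappa_var (n : ℕ) : RapidOn δ fun ε s => deriv (fun e => iteratedDeriv n (κ e) s) ε
  tau (n : ℕ) : SlowOn δ fun ε s => iteratedDeriv n (τ ε) s
  tau_var (n : ℕ) : SlowOn δ fun ε s => deriv (fun e => iteratedDeriv n (τ e) s) ε

section Tame

variable {δ : ℝ} {κ τ : ℝ → ℝ → ℝ}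

/-- The claims are proved in one induction because they feed each other: the antiderivative needs
decay of both `u` and `v`, their continuity, which comes from the s-derivatives, and the derivative
in ε. The last claim says that the s-derivatives again form a tame pair, so ∂_ε and ∂ₛ commute on
the class. -/
lemma Tame.controlled_and_deriv (h : UniformControl δ κ τ) {d : Bool} {u v : ℝ → ℝ → ℝ}
    (huv : Tame δ κ τ d u v) : ControlledOn δ d u ∧ ControlledOn δ d v ∧
      (∀ ε, |ε| < δ → ∀ s, HasDerivAt (fun e => u e s) (v ε s) ε) ∧
      ∃ u' v', Tame δ κ τ d u' v' ∧ ∀ ε, |ε| < δ → ∀ s,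
        HasDerivAt (u ε) (u' ε s) s ∧ HasDerivAt (v ε) (v' ε s) s := by
  induction huv with
  | kappa n =>
    have hs := h.smooth_kappa.iteratedDeriv n
    refine ⟨h.kappa n, h.kappa_var n, fun ε _ s => hs.hasDerivAt_fst' ε s, _, _, kappa (n + 1),
      fun ε _ s => ?_⟩
    simp only [iteratedDeriv_succ]
    refine ⟨hs.hasDerivAt_snd' ε s, ?_⟩
    -- The pair at n + 1 contains ∂_ε∂ₛ of the n-th derivative, whereas ∂ₛ∂_ε is wanted.
    rw [← hs.deriv_comm]
    exact hs.deriv_fst.hasDerivAt_snd' ε s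
  | tau n =>
    have hs := h.smooth_tau.iteratedDeriv n
    refine ⟨h.tau n, h.tau_var n, fun ε _ s => hs.hasDerivAt_fst' ε s, _, _, tau (n + 1),
      fun ε _ s => ?_⟩
    simp only [iteratedDeriv_succ]
    refine ⟨hs.hasDerivAt_snd' ε s, ?_⟩
    rw [← hs.deriv_comm]
    exact hs.deriv_fst.hasDerivAt_snd' ε s
  | param =>
    refine ⟨⟨1, 1, zero_le_one, fun ε _ s => ?_⟩, ⟨0, 0, le_rfl, fun ε _ s => by simp⟩,
      fun ε _ s => hasDerivAt_const _ _, _, _, const 1,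
      fun ε _ s => ⟨hasDerivAt_id s, hasDerivAt_const _ _⟩⟩
    rw [one_mul, pow_one]
    nlinarith [sq_nonneg (|s| - 1), sq_abs s, abs_nonneg s]
  | const c =>
    exact ⟨⟨|c|, 0, abs_nonneg c, fun ε _ s => by simp⟩, ⟨0, 0, le_rfl, fun ε _ s => by simp⟩,
      fun ε _ s => hasDerivAt_const _ _, _, _, const 0,
      fun ε _ s => ⟨hasDerivAt_const _ _, hasDerivAt_const _ _⟩⟩
  | add _ _ ih ih₁ =>
    obtain ⟨hu, hv, hd, u', v', ht, hs⟩ := ih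
    obtain ⟨hu₁, hv₁, hd₁, u₁', v₁', ht₁, hs₁⟩ := ih₁
    exact ⟨hu.add hu₁, hv.add hv₁, fun ε hε s => (hd ε hε s).add (hd₁ ε hε s), _, _,
      ht.add ht₁, fun ε hε s => ⟨(hs ε hε s).1.add (hs₁ ε hε s).1,
        (hs ε hε s).2.add (hs₁ ε hε s).2⟩⟩
  | mul t t₁ ih ih₁ =>
    obtain ⟨hu, hv, hd, u', v', ht, hs⟩ := ih
    obtain ⟨hu₁, hv₁, hd₁, u₁', v₁', ht₁, hs₁⟩ := ih₁
    refine ⟨hu.mul hu₁, (hv.mul hu₁).add (hu.mul hv₁),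
      fun ε hε s => (hd ε hε s).mul (hd₁ ε hε s), _, _, (ht.mul t₁).add (t.mul ht₁),
      fun ε hε s => ⟨(hs ε hε s).1.mul (hs₁ ε hε s).1, ?_⟩⟩
    refine (((hs ε hε s).2.mul (hs₁ ε hε s).1).add
      ((hs ε hε s).1.mul (hs₁ ε hε s).2)).congr_deriv ?_
    ring
  | slow _ ih =>
    obtain ⟨hu, hv, hd, u', v', ht, hs⟩ := ih
    exact ⟨hu.slow, hv.slow, hd, u', v', ht.slow, hs⟩
  | antiD t ih =>
    obtain ⟨hu, hv, hd, u', v', ht, hs⟩ := ih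
    have huc := fun ε hε => continuous_iff_continuousAt.mpr fun s => (hs ε hε s).1.continuousAt
    have hvc := fun ε hε => continuous_iff_continuousAt.mpr fun s => (hs ε hε s).2.continuousAt
    exact ⟨RapidOn.antiD hu huc, RapidOn.antiD hv hvc,
      fun ε hε s => hasDerivAt_antiD_family hu hv huc hvc hd hε s, _, _, t.slow,
      fun ε hε s => ⟨hasDerivAt_antiD (RapidOn.integrable hu hε (huc ε hε)) (huc ε hε) s,
        hasDerivAt_antiD (RapidOn.integrable hv hε (hvc ε hε)) (hvc ε hε) s⟩⟩
  | congr _ heq ih =>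
    obtain ⟨hu, hv, hd, u', v', ht, hs⟩ := ih
    refine ⟨hu.congr heq, hv, fun ε hε s => ?_, u', v', ht,
      fun ε hε s => ⟨heq ε hε ▸ (hs ε hε s).1, (hs ε hε s).2⟩⟩
    refine (hd ε hε s).congr_of_eventuallyEq ?_
    filter_upwards [eventually_abs_lt hε] with e he
    rw [heq e he]

lemma Tame.hasDerivAt (h : UniformControl δ κ τ) {d : Bool} {u v : ℝ → ℝ → ℝ}
    (huv : Tame δ κ τ d u v) {ε : ℝ} (hε : |ε| < δ) (s : ℝ) :
    HasDerivAt (fun e => u e s) (v ε s) ε := (huv.controlled_and_deriv h).2.2.1 ε hε s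

lemma Tame.deriv (h : UniformControl δ κ τ) {d : Bool} {u v : ℝ → ℝ → ℝ}
    (huv : Tame δ κ τ d u v) : ∃ v', Tame δ κ τ d (fun ε s => deriv (u ε) s) v' := by
  obtain ⟨u', v', ht, hs⟩ := (huv.controlled_and_deriv h).2.2.2
  exact ⟨v', ht.congr fun ε hε => funext fun s => (hs ε hε s).1.deriv.symm⟩

end Tame

/-! ## Mixed derivatives at the base point of a variation -/

section Mixed

variable {E : Type*} [NormedAddCommGroup E] [NormedSpace ℝ E]

/-- The derivatives of `F` in the parameter, at `0`, and in the variable commute. -/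
def MixedAt (F : ℝ → ℝ → E) : Prop :=
  ∃ (v : ℝ → E) (p : ℝ → ℝ → E) (r : ℝ → E), (∀ s, HasDerivAt (fun e => F e s) (v s) 0) ∧
    (∀ᶠ e in 𝓝 0, ∀ s, HasDerivAt (F e) (p e s) s) ∧
    ∀ s, HasDerivAt v (r s) s ∧ HasDerivAt (fun e => p e s) (r s) 0

lemma MixedAt.add {F G : ℝ → ℝ → E} (hF : MixedAt F) (hG : MixedAt G) :
    MixedAt fun ε s => F ε s + G ε s := by
  obtain ⟨v, p, r, hv, hp, hr⟩ := hF
  obtain ⟨w, q, t, hw, hq, ht⟩ := hG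
  refine ⟨_, fun e s => p e s + q e s, _, fun s => (hv s).add (hw s), ?_,
    fun s => ⟨(hr s).1.add (ht s).1, (hr s).2.add (ht s).2⟩⟩
  filter_upwards [hp, hq] with e h1 h2 s
  exact (h1 s).add (h2 s)

lemma MixedAt.smul {a : ℝ → ℝ → ℝ} {F : ℝ → ℝ → E} (ha : MixedAt a) (hF : MixedAt F) :
    MixedAt fun ε s => a ε s • F ε s := by
  obtain ⟨v, p, r, hv, hp, hr⟩ := ha
  obtain ⟨w, q, t, hw, hq, ht⟩ := hF
  refine ⟨_, fun e s => a e s • q e s + p e s • F e s, _, fun s => (hv s).smul (hw s), ?_,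
    fun s => ⟨((hp.self_of_nhds s).smul (ht s).1).add ((hr s).1.smul (hq.self_of_nhds s)),
      (((hv s).smul (ht s).2).add ((hr s).2.smul (hw s))).congr_deriv (by module)⟩⟩
  filter_upwards [hp, hq] with e h1 h2 s
  exact (h1 s).smul (h2 s)

lemma JointSmooth.mixedAt {F : ℝ → ℝ → E} (hF : JointSmooth F) : MixedAt F := by
  refine ⟨_, _, _, fun s => hF.hasDerivAt_fst' 0 s, Eventually.of_forall hF.hasDerivAt_snd',
    fun s => ⟨hF.deriv_fst.hasDerivAt_snd' 0 s, ?_⟩⟩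
  rw [hF.deriv_comm]
  exact hF.deriv_snd.hasDerivAt_fst' 0 s

/-- The ε-derivative `v'` of `u'` is also the s-derivative of `v`. This replaces joint smoothness,
which is not at hand for antiderivatives. -/
lemma Tame.mixedAt {δ : ℝ} {κ τ : ℝ → ℝ → ℝ} (h : UniformControl δ κ τ) (hδ : 0 < δ) {d : Bool}
    {u v : ℝ → ℝ → ℝ} (huv : Tame δ κ τ d u v) : MixedAt u := by
  have h0 : |(0 : ℝ)| < δ := by simpa using hδ
  obtain ⟨u', v', ht, hs⟩ := (huv.controlled_and_deriv h).2.2.2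
  exact ⟨v 0, u', v' 0, huv.hasDerivAt h h0,
    (eventually_abs_lt h0).mono fun e he s => (hs e he s).1,
    fun s => ⟨(hs 0 h0 s).2, ht.hasDerivAt h h0 s⟩⟩

lemma MixedAt.hasDerivAt_deriv {F : ℝ → ℝ → E} (hF : MixedAt F) {W : ℝ → E}
    (hW : ∀ s, HasDerivAt (fun e => F e s) (W s) 0) (s : ℝ) :
    HasDerivAt (fun e => deriv (F e) s) (deriv W s) 0 := by
  obtain ⟨v, p, r, hv, hp, hr⟩ := hF
  obtain rfl : W = v := funext fun s => (hW s).unique (hv s)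
  rw [(hr s).1.deriv]
  refine (hr s).2.congr_of_eventuallyEq ?_
  filter_upwards [hp] with e he
  exact (he s).deriv

end Mixed

section

variable {γ₀ : ℝ → E3}

/-! ## Variations of curves -/

namespace IsVariation

variable {V : TangentField γ₀} {γ : BAL γ₀} {Γ : ℝ → BAL γ₀}

lemma jointSmooth (h : IsVariation V γ Γ) : JointSmooth fun ε => (Γ ε).1 := h.smooth

lemma jointSmooth_T (h : IsVariation V γ Γ) : JointSmooth fun ε => tangentVec (Γ ε).1 :=
  h.jointSmooth.deriv_snd

lemma jointSmooth_curvature (h : IsVariation V γ Γ) : JointSmooth fun ε => curvature (Γ ε).1 :=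
  ContDiff.norm ℝ h.jointSmooth_T.deriv_snd fun q =>
    norm_ne_zero_iff.mp ((Γ q.1).2.curvature_ne_zero q.2)

lemma jointSmooth_N (h : IsVariation V γ Γ) : JointSmooth fun ε => normalVec (Γ ε).1 :=
  (ContDiff.inv h.jointSmooth_curvature fun q => (Γ q.1).2.curvature_ne_zero q.2).smul
    h.jointSmooth_T.deriv_snd

lemma jointSmooth_B (h : IsVariation V γ Γ) : JointSmooth fun ε => binormalVec (Γ ε).1 :=
  (crossCLM.isBoundedBilinearMap.contDiff).comp₂ h.jointSmooth_T h.jointSmooth_N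

lemma jointSmooth_torsion (h : IsVariation V γ Γ) : JointSmooth fun ε => torsion (Γ ε).1 :=
  ContDiff.inner ℝ h.jointSmooth_N.deriv_snd h.jointSmooth_B

/-- Here |u| ≤ κP, and κ times any polynomial, in particular P(1 + s²)^k, is bounded uniformly. -/
lemma rapidOn_of_le {δ : ℝ} {κ u : ℝ → ℝ → ℝ} (hκ : ∀ ε s, 0 < κ ε s)
    (hdecay : ∀ P : Polynomial ℝ, ∃ C : ℝ, ∀ ε, |ε| < δ → ∀ s, |κ ε s * P.eval s| ≤ C)
    {P : Polynomial ℝ} (hu : ∀ ε, |ε| < δ → ∀ s, |(κ ε s)⁻¹ * u ε s| ≤ P.eval s) :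
    RapidOn δ u := by
  intro k
  obtain ⟨C, hC⟩ := hdecay (P * (1 + Polynomial.X ^ 2) ^ k)
  refine ⟨C, fun ε hε s => ?_⟩
  have h1 := hu ε hε s
  rw [abs_mul, abs_of_pos (inv_pos.mpr (hκ ε s)), inv_mul_le_iff₀ (hκ ε s)] at h1
  refine (mul_le_mul_of_nonneg_right h1 (zero_le_one.trans (one_le_weight s k))).trans
    ((le_of_eq ?_).trans ((le_abs_self _).trans (hC ε hε s)))
  rw [Polynomial.eval_mul, one_add_sq_pow_eval]
  ring

lemma slowOn_of_le {δ : ℝ} {u : ℝ → ℝ → ℝ} {P : Polynomial ℝ}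
    (hu : ∀ ε, |ε| < δ → ∀ s, |u ε s| ≤ P.eval s) : SlowOn δ u := by
  obtain ⟨C, k, hC, h⟩ := polynomial_abs_eval_le P
  exact ⟨C, k, hC, fun ε hε s => (hu ε hε s).trans ((le_abs_self _).trans (h s))⟩

lemma uniformControl (h : IsVariation V γ Γ) : ∃ δ > 0,
    UniformControl δ (fun ε => curvature (Γ ε).1) (fun ε => torsion (Γ ε).1) := by
  obtain ⟨δ, hδ, hdecay, hn⟩ := h.uniform
  choose P hP using hn
  exact ⟨δ, hδ, h.jointSmooth_curvature, h.jointSmooth_torsion,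
    fun n => rapidOn_of_le (fun ε => (Γ ε).curvature_pos) hdecay fun ε hε s => (hP n ε hε s).1,
    fun n => rapidOn_of_le (fun ε => (Γ ε).curvature_pos) hdecay
      fun ε hε s => (hP n ε hε s).2.2.1,
    fun n => slowOn_of_le fun ε hε s => (hP n ε hε s).2.1,
    fun n => slowOn_of_le fun ε hε s => (hP n ε hε s).2.2.2⟩

lemma hasDerivAt_T (h : IsVariation V γ Γ) (s : ℝ) :
    HasDerivAt (fun ε => tangentVec (Γ ε).1 s) (deriv (V γ) s) 0 :=
  h.jointSmooth.mixedAt.hasDerivAt_deriv h.velocity s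

lemma hasDerivAt_deriv_T (h : IsVariation V γ Γ) (s : ℝ) :
    HasDerivAt (fun ε => deriv (tangentVec (Γ ε).1) s) (deriv (deriv (V γ)) s) 0 :=
  h.jointSmooth_T.mixedAt.hasDerivAt_deriv h.hasDerivAt_T s

end IsVariation

/-! ### Variations of the members of the hierarchies -/

/-- Fields whose coefficients are tame along the family `Γ` of curves. -/
def TameField (δ : ℝ) (Γ : ℝ → BAL γ₀) (X : NormalField γ₀) : Prop :=
  (∃ v, Tame δ (fun ε => curvature (Γ ε).1) (fun ε => torsion (Γ ε).1) true
    (fun ε => X.1 (Γ ε)) v) ∧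
  ∃ v, Tame δ (fun ε => curvature (Γ ε).1) (fun ε => torsion (Γ ε).1) true (fun ε => X.2 (Γ ε)) v

section

variable {δ : ℝ} {Γ : ℝ → BAL γ₀}

lemma tame_curvature : Tame δ (fun ε => curvature (Γ ε).1) (fun ε => torsion (Γ ε).1) true
    (fun ε => curvature (Γ ε).1) (fun ε s => deriv (fun e => curvature (Γ e).1 s) ε) := by
  simpa using Tame.kappa (δ := δ) (κ := fun ε => curvature (Γ ε).1)
    (τ := fun ε => torsion (Γ ε).1) 0

lemma tame_torsion : Tame δ (fun ε => curvature (Γ ε).1) (fun ε => torsion (Γ ε).1) false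
    (fun ε => torsion (Γ ε).1) (fun ε s => deriv (fun e => torsion (Γ e).1 s) ε) := by
  simpa using Tame.tau (δ := δ) (κ := fun ε => curvature (Γ ε).1)
    (τ := fun ε => torsion (Γ ε).1) 0

lemma TameField.recOp
    (hc : UniformControl δ (fun ε => curvature (Γ ε).1) (fun ε => torsion (Γ ε).1))
    {X : NormalField γ₀} (hX : SchField X) (h : TameField δ Γ X) :
    TameField δ Γ (recOp X) := by
  obtain ⟨⟨v, hv⟩, ⟨w, hw⟩⟩ := h
  obtain ⟨v', hv'⟩ := hv.deriv hc
  obtain ⟨w', hw'⟩ := hw.deriv hc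
  rw [recOp_eq hX]
  constructor
  · refine ⟨_, (hw'.add (hv.mul tame_torsion)).congr fun ε _ => ?_⟩
    ext1 s
    simp [dS, tau, mul_comm]
  · have hf := tame_curvature.mul ((tame_curvature (δ := δ) (Γ := Γ)).mul hv.slow).antiD
    refine ⟨_, ((hf.add (hv'.add ((hw.mul tame_torsion).mul (Tame.const (-1))))).mul
      (Tame.const (-1))).congr fun ε _ => ?_⟩
    ext1 s
    simp only [dS, tau, kappa, antiS, antiD, Pi.smul_apply, Pi.add_apply, Pi.mul_apply,
      smul_eq_mul]
    ring

lemma tameField_hierarchy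
    (hc : UniformControl δ (fun ε => curvature (Γ ε).1) (fun ε => torsion (Γ ε).1))
    (b c : ℝ) (n : ℕ) : TameField δ Γ (hierarchy γ₀ b c n) := by
  induction n with
  | zero =>
    constructor
    -- Constants are tame only with the slow flag, so the zero coefficient is written as κ · 0 to
    -- carry the rapid one.
    · refine ⟨_, (tame_curvature.mul (Tame.const 0)).congr fun ε _ => ?_⟩
      ext1 s
      simp [hierarchy]
    · refine ⟨_, (tame_curvature.mul ((Tame.param.mul (Tame.const b)).add
        (Tame.const c))).congr fun ε _ => ?_⟩
      ext1 s
      simp [hierarchy, param, kappa]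
      ring
  | succ n ih =>
    rw [hierarchy_succ]
    exact ih.recOp hc (schField_hierarchy b c n)

lemma TameField.mixedAt_lift {V : TangentField γ₀} {γ : BAL γ₀} (h : IsVariation V γ Γ)
    (hδ : 0 < δ) (hc : UniformControl δ (fun ε => curvature (Γ ε).1) (fun ε => torsion (Γ ε).1))
    {X : NormalField γ₀} (hX : TameField δ Γ X) : MixedAt fun ε => lift X (Γ ε) := by
  obtain ⟨⟨v, hv⟩, ⟨w, hw⟩⟩ := hX
  exact ((((tame_curvature (δ := δ) (Γ := Γ)).mul hv.slow).antiD.mixedAt hc hδ).smul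
    h.jointSmooth_T.mixedAt).add ((hv.mixedAt hc hδ).smul h.jointSmooth_N.mixedAt) |>.add
    ((hw.mixedAt hc hδ).smul h.jointSmooth_B.mixedAt)

end

/-- The variation of the field of a successor jet. -/
lemma hasDerivAt_lift_recOp {V : TangentField γ₀} {γ : BAL γ₀} {Γ : ℝ → BAL γ₀}
    (h : IsVariation V γ Γ) {δ : ℝ} (hδ : 0 < δ)
    (hc : UniformControl δ (fun ε => curvature (Γ ε).1) (fun ε => torsion (Γ ε).1))
    {X : NormalField γ₀} (hX : SchField X) (hXt : TameField δ Γ X) {W : ℝ → E3}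
    (hW : ∀ s, HasDerivAt (fun ε => lift X (Γ ε) s) (W s) 0) (s : ℝ) :
    HasDerivAt (fun ε => lift (recOp X) (Γ ε) s)
      (nextVar (tangentVec γ.1) (lift X γ) (V γ) W s) 0 := by
  have hT := h.hasDerivAt_T
  have hT' := h.hasDerivAt_deriv_T
  have hV' := (hXt.mixedAt_lift h hδ hc).hasDerivAt_deriv hW
  obtain rfl := h.base
  obtain ⟨⟨g, hg⟩, -⟩ := hXt.recOp hc hX
  have hq := (tame_curvature (δ := δ) (Γ := Γ)).mul hg.slow
  have h0 : |(0 : ℝ)| < δ := by simpa using hδ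
  have hden : ∀ t, HasDerivAt (fun ε => tangentialDensity (tangentVec (Γ ε).1) (lift X (Γ ε)) t)
      (tangentialDensityVar (tangentVec (Γ 0).1) (lift X (Γ 0)) (V (Γ 0)) W t) 0 := by
    intro t
    refine ((hT t).inner ℝ (hasDerivAt_cross (hT' t) (hV' t))).congr_deriv ?_
    rw [tangentialDensityVar, inner_add_right]
    ring
  have hanti := hq.antiD.hasDerivAt hc h0 s
  -- Tameness gives some ε-derivative of the integrand; by uniqueness of derivatives it is the
  -- geometric expression for the variation of the density.
  rw [show (fun s => deriv (fun e => curvature (Γ e).1 s) 0 * (recOp X).1 (Γ 0) s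
      + curvature (Γ 0).1 s * g 0 s) =
      tangentialDensityVar (tangentVec (Γ 0).1) (lift X (Γ 0)) (V (Γ 0)) W from
    funext fun t => (hq.hasDerivAt hc h0 t).unique
      (by simpa only [tangentialDensity_lift] using hden t)] at hanti
  simp only [lift_recOp hX, nextField]
  simp only [tangentialDensity_lift] at hanti ⊢
  refine ((hasDerivAt_cross (hT s) (hV' s)).neg.add (hanti.smul (hT s))).congr_deriv ?_
  rw [nextVar, tangentialDensity_lift]
  module

/-- The bridge between the formal calculus of jets and true variations of curves: each recursion
step is differentiated by `hasDerivAt_lift_recOp`. -/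
lemma hasDerivAt_lift_hierarchy {V : TangentField γ₀} {γ : BAL γ₀} {Γ : ℝ → BAL γ₀}
    (h : IsVariation V γ Γ) (hV : IsDirection (tangentVec γ.1) (V γ)) (b c : ℝ) (n : ℕ) (s : ℝ) :
    HasDerivAt (fun ε => lift (hierarchy γ₀ b c n) (Γ ε) s)
      ((γ.chain b c (n + 1)).var (V γ) s) 0 := by
  obtain ⟨δ, hδ, hc⟩ := h.uniformControl
  induction n generalizing s with
  | zero =>
    rw [BAL.chain, chain_one_var γ.isIndicatrix γ.hasDerivAt_curve b c hV]
    simp only [lift_hierarchy_zero, curvature_smul_B]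
    have h1 := (hasDerivAt_cross (h.hasDerivAt_T s) (h.hasDerivAt_deriv_T s)).const_smul (b * s + c)
    rwa [h.base] at h1
  | succ n ih =>
    have h1 := hasDerivAt_lift_recOp h hδ hc (schField_hierarchy b c n)
      (tameField_hierarchy hc b c n) ih s
    rwa [← hierarchy_succ, lift_hierarchy] at h1

/-! ## Commutators of vector fields -/

lemma lift_add {X Y : NormalField γ₀} (hX : SchField X) (hY : SchField Y) (γ : BAL γ₀) :
    lift (X + Y) γ = lift X γ + lift Y γ := by
  ext1 s
  have h := antiD_add (hX.density γ).integrable (hY.density γ).integrable s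
  simp only [← mul_add] at h
  simp only [lift_apply, Pi.add_apply, Prod.fst_add, Prod.snd_add, h]
  module

lemma lift_smul (a : ℝ) (X : NormalField γ₀) (γ : BAL γ₀) :
    lift (a • X) γ = a • lift X γ := by
  ext1 s
  have h := antiD_const_mul a (fun t => curvature γ.1 t * X.1 γ t) s
  simp only [mul_left_comm a] at h
  simp only [lift_apply, Pi.smul_apply, Prod.smul_fst, Prod.smul_snd, smul_eq_mul, h]
  module

lemma lift_zero (γ : BAL γ₀) : lift (0 : NormalField γ₀) γ = 0 := by
  simpa using lift_smul 0 (0 : NormalField γ₀) γ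

lemma schField_zero : SchField (0 : NormalField γ₀) := fun _ => ⟨IsSch.zero, IsSch.zero⟩

lemma SchField.add {X Y : NormalField γ₀} (hX : SchField X) (hY : SchField Y) :
    SchField (X + Y) := fun γ => ⟨(hX γ).1.add (hY γ).1, (hX γ).2.add (hY γ).2⟩

lemma SchField.smul (a : ℝ) {X : NormalField γ₀} (hX : SchField X) : SchField (a • X) :=
  fun γ => ⟨(hX γ).1.const_smul a, (hX γ).2.const_smul a⟩

variable (γ₀) in
/-- Variations of a field, as functions of the curve and of the direction of variation. -/
abbrev VarOperator : Type := BAL γ₀ → (ℝ → E3) → ℝ → E3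

/-- `D` is linear in the direction and gives the variation of the field `X`. -/
structure IsVarOperator (X : NormalField γ₀) (D : VarOperator γ₀) : Prop where
  sch : SchField X
  add : ∀ γ A B, IsDirection (tangentVec γ.1) A → IsDirection (tangentVec γ.1) B →
    D γ (A + B) = D γ A + D γ B
  smul : ∀ γ (a : ℝ) A, IsDirection (tangentVec γ.1) A → D γ (a • A) = a • D γ A
  hasDerivAt : ∀ V γ Γ, IsVariation V γ Γ → IsDirection (tangentVec γ.1) (V γ) →
    ∀ s, HasDerivAt (fun ε => lift X (Γ ε) s) (D γ (V γ) s) 0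

variable (γ₀) in
/-- The space of fields with a variation. -/
def varFields : Submodule ℝ (NormalField γ₀ × VarOperator γ₀) where
  carrier := {p | IsVarOperator p.1 p.2}
  add_mem' {p q} hp hq :=
    { sch := hp.sch.add hq.sch
      add := fun γ A B hA hB => by
        simp only [Prod.snd_add, Pi.add_apply, hp.add γ A B hA hB, hq.add γ A B hA hB]
        abel
      smul := fun γ a A hA => by
        simp only [Prod.snd_add, Pi.add_apply, hp.smul γ a A hA, hq.smul γ a A hA, smul_add]
      hasDerivAt := fun V γ Γ h hV s => by
        simp only [Prod.fst_add, lift_add hp.sch hq.sch]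
        exact (hp.hasDerivAt V γ Γ h hV s).add (hq.hasDerivAt V γ Γ h hV s) }
  zero_mem' :=
    { sch := schField_zero
      add := fun γ A B _ _ => by simp
      smul := fun γ a A _ => by simp
      hasDerivAt := fun V γ Γ _ _ s => by
        simpa [lift_zero] using hasDerivAt_const (0 : ℝ) (0 : E3) }
  smul_mem' r p hp :=
    { sch := hp.sch.smul r
      add := fun γ A B hA hB => by
        simp only [Prod.smul_snd, Pi.smul_apply, hp.add γ A B hA hB, smul_add]
      smul := fun γ a A hA => by
        simp only [Prod.smul_snd, Pi.smul_apply, hp.smul γ a A hA, smul_comm r a]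
      hasDerivAt := fun V γ Γ h hV s => by
        simp only [Prod.smul_fst, lift_smul]
        exact (hp.hasDerivAt V γ Γ h hV s).const_smul r }

/-- The commutator of two fields with given variations. -/
def varBracket (p q : NormalField γ₀ × VarOperator γ₀) (γ : BAL γ₀) : ℝ → E3 :=
  q.2 γ (lift p.1 γ) - p.2 γ (lift q.1 γ)

lemma varBracket_swap (p q : NormalField γ₀ × VarOperator γ₀) (γ : BAL γ₀) :
    varBracket q p γ = -varBracket p q γ := by simp [varBracket]

lemma varBracket_add {p q r : NormalField γ₀ × VarOperator γ₀} (hp : p ∈ varFields γ₀)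
    (hq : q ∈ varFields γ₀) (hr : r ∈ varFields γ₀) (γ : BAL γ₀) :
    varBracket p (q + r) γ = varBracket p q γ + varBracket p r γ := by
  simp only [varBracket, Prod.fst_add, Prod.snd_add, lift_add hq.sch hr.sch, Pi.add_apply,
    hp.add γ _ _ (isDirection_lift hq.sch γ) (isDirection_lift hr.sch γ)]
  abel

lemma varBracket_smul (a : ℝ) {p q : NormalField γ₀ × VarOperator γ₀} (hp : p ∈ varFields γ₀)
    (hq : q ∈ varFields γ₀) (γ : BAL γ₀) :
    varBracket p (a • q) γ = a • varBracket p q γ := by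
  simp only [varBracket, Prod.smul_fst, Prod.smul_snd, lift_smul, Pi.smul_apply,
    hp.smul γ a _ (isDirection_lift hq.sch γ), smul_sub]

/-- The variation operators of the pairs serve as the two variational derivatives, and φ ∘ ℘ = id
recovers `Z`. -/
lemma isCommutator_of_varBracket {p q : NormalField γ₀ × VarOperator γ₀} (hp : p ∈ varFields γ₀)
    (hq : q ∈ varFields γ₀) {Z : NormalField γ₀} (h : ∀ γ, varBracket p q γ = lift Z γ) :
    IsCommutator p.1 q.1 Z := by
  refine ⟨fun γ => q.2 γ (lift p.1 γ), fun γ => p.2 γ (lift q.1 γ),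
    fun γ Γ hΓ s => hq.hasDerivAt _ γ Γ hΓ (isDirection_lift hp.sch γ) s,
    fun γ Γ hΓ s => hp.hasDerivAt _ γ Γ hΓ (isDirection_lift hq.sch γ) s, ?_⟩
  rw [← proj_lift Z, ← funext h]
  refine Prod.ext ?_ ?_ <;> ext γ s <;> simp [proj, varBracket, inner_sub_right]

/-! ### The hierarchies as fields with a variation -/

variable (γ₀) in
/-- A member of the hierarchies, with its variation. -/
def hierarchyPair (b c : ℝ) (n : ℕ) : NormalField γ₀ × VarOperator γ₀ :=
  (hierarchy γ₀ b c n, fun γ => (γ.chain b c (n + 1)).var)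

lemma hierarchyPair_mem (b c : ℝ) (n : ℕ) : hierarchyPair γ₀ b c n ∈ varFields γ₀ where
  sch := schField_hierarchy b c n
  add γ := (chain_good γ.isIndicatrix γ.hasDerivAt_curve b c (n + 1)).add
  smul γ := (chain_good γ.isIndicatrix γ.hasDerivAt_curve b c (n + 1)).smul
  hasDerivAt _ _ _ h hV := hasDerivAt_lift_hierarchy h hV b c n

lemma varBracket_hierarchyPair (b c b' c' : ℝ) (n m : ℕ) (γ : BAL γ₀) :
    varBracket (hierarchyPair γ₀ b c n) (hierarchyPair γ₀ b' c' m) γ =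
      bracket (γ.chain b c (n + 1)) (γ.chain b' c' (m + 1)) := by
  simp only [varBracket, hierarchyPair, lift_hierarchy]
  rfl

lemma varBracket_symmetries (n m : ℕ) (γ : BAL γ₀) :
    varBracket (hierarchyPair γ₀ 0 1 n) (hierarchyPair γ₀ 0 1 m) γ =
      lift (0 : NormalField γ₀) γ := by
  rw [varBracket_hierarchyPair, lift_zero]
  exact bracket_symmetries γ.isIndicatrix γ.hasDerivAt_curve (Nat.le_add_left 1 n)
    (Nat.le_add_left 1 m)

lemma varBracket_symmetry_master (n m : ℕ) (γ : BAL γ₀) :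
    varBracket (hierarchyPair γ₀ 0 1 n) (hierarchyPair γ₀ 1 0 m) γ =
      lift (((n : ℝ) + 2) • hierarchy γ₀ 0 1 (n + m + 1)) γ := by
  rw [varBracket_hierarchyPair, lift_smul, lift_hierarchy]
  refine (bracket_symmetry_master γ.isIndicatrix γ.hasDerivAt_curve (Nat.le_add_left 1 n)
    (Nat.le_add_left 1 m)).trans ?_
  rw [BAL.chain, show n + 1 + (m + 1) = n + m + 1 + 1 by ring]
  push_cast
  module

lemma varBracket_masters (n m : ℕ) (γ : BAL γ₀) :
    varBracket (hierarchyPair γ₀ 1 0 n) (hierarchyPair γ₀ 1 0 m) γ =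
      lift (((n : ℝ) - m) • hierarchy γ₀ 1 0 (n + m + 1)) γ := by
  rw [varBracket_hierarchyPair, lift_smul, lift_hierarchy]
  refine (bracket_masters γ.isIndicatrix γ.hasDerivAt_curve (Nat.le_add_left 1 n)
    (Nat.le_add_left 1 m)).trans ?_
  rw [BAL.chain, show n + 1 + (m + 1) = n + m + 1 + 1 by ring]
  push_cast
  module

/-! ### Closure of the span under the commutator -/

variable (γ₀) in
/-- The members of the two hierarchies, with their variations. -/
def generators : Set (NormalField γ₀ × VarOperator γ₀) :=
  Set.range (hierarchyPair γ₀ 0 1) ∪ Set.range (hierarchyPair γ₀ 1 0)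

lemma generators_subset : Submodule.span ℝ (generators γ₀) ≤ varFields γ₀ := by
  refine Submodule.span_le.mpr ?_
  rintro _ (⟨n, rfl⟩ | ⟨n, rfl⟩) <;> exact hierarchyPair_mem _ _ n

lemma symSpan_eq : symSpan γ₀ =
    (Submodule.span ℝ (generators γ₀)).map (LinearMap.fst ℝ (NormalField γ₀) (VarOperator γ₀)) := by
  rw [Submodule.map_span, symSpan]
  congr 1
  ext X
  simp only [generators, Set.image_union, Set.mem_union, Set.mem_range, Set.mem_image,
    exists_exists_eq_and, LinearMap.fst_apply, hierarchyPair, symX_eq, masterY_eq, Set.mem_ofPred_eq]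
  refine or_congr Iff.rfl ⟨?_, ?_⟩
  -- The master fields are numbered from 1 and the hierarchy from 0.
  · rintro ⟨n, -, rfl⟩
    exact ⟨n - 1, rfl⟩
  · rintro ⟨n, rfl⟩
    exact ⟨n + 1, Nat.le_add_left 1 n, rfl⟩

lemma hierarchy_mem_symSpan_symmetry (n : ℕ) : hierarchy γ₀ 0 1 n ∈ symSpan γ₀ :=
  Submodule.subset_span (Or.inl ⟨n, symX_eq n⟩)

lemma hierarchy_mem_symSpan_master (n : ℕ) : hierarchy γ₀ 1 0 n ∈ symSpan γ₀ :=
  Submodule.subset_span (Or.inr ⟨n + 1, Nat.le_add_left 1 n, masterY_eq (n + 1)⟩)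

/-- The commutator of `p` and `q` is a field of the span of the two hierarchies. -/
def BracketInSpan (p q : NormalField γ₀ × VarOperator γ₀) : Prop :=
  ∃ W ∈ symSpan γ₀, SchField W ∧ ∀ γ, varBracket p q γ = lift W γ

lemma BracketInSpan.swap {p q : NormalField γ₀ × VarOperator γ₀} (h : BracketInSpan p q) :
    BracketInSpan q p := by
  obtain ⟨W, hW, hs, h⟩ := h
  refine ⟨(-1 : ℝ) • W, Submodule.smul_mem _ _ hW, hs.smul _, fun γ => ?_⟩
  rw [varBracket_swap, h, lift_smul, neg_one_smul]

lemma bracketInSpan_of_mem_span {p q : NormalField γ₀ × VarOperator γ₀} (hp : p ∈ varFields γ₀)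
    (hq : q ∈ Submodule.span ℝ (generators γ₀)) (h : ∀ r ∈ generators γ₀, BracketInSpan p r) :
    BracketInSpan p q := by
  induction hq using Submodule.span_induction with
  | mem r hr => exact h r hr
  | zero =>
    refine ⟨0, zero_mem _, schField_zero, fun γ => ?_⟩
    rw [lift_zero]
    simpa using varBracket_smul 0 hp (zero_mem _) γ
  | add r t hr ht ihr iht =>
    obtain ⟨W, hW, hWs, h1⟩ := ihr
    obtain ⟨Z, hZ, hZs, h2⟩ := iht
    refine ⟨W + Z, add_mem hW hZ, hWs.add hZs, fun γ => ?_⟩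
    rw [varBracket_add hp (generators_subset hr) (generators_subset ht), h1, h2, lift_add hWs hZs]
  | smul a r hr ih =>
    obtain ⟨W, hW, hWs, h1⟩ := ih
    refine ⟨a • W, Submodule.smul_mem _ a hW, hWs.smul a, fun γ => ?_⟩
    rw [varBracket_smul a hp (generators_subset hr), h1, lift_smul]

lemma bracketInSpan_generators {p q : NormalField γ₀ × VarOperator γ₀} (hp : p ∈ generators γ₀)
    (hq : q ∈ generators γ₀) : BracketInSpan p q := by
  have hXY : ∀ n m, BracketInSpan (hierarchyPair γ₀ 0 1 n) (hierarchyPair γ₀ 1 0 m) := fun n m =>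
    ⟨_, Submodule.smul_mem _ _ (hierarchy_mem_symSpan_symmetry _),
      (schField_hierarchy _ _ _).smul _, varBracket_symmetry_master n m⟩
  obtain ⟨n, rfl⟩ | ⟨n, rfl⟩ := hp <;> obtain ⟨m, rfl⟩ | ⟨m, rfl⟩ := hq
  · exact ⟨0, zero_mem _, schField_zero, varBracket_symmetries n m⟩
  · exact hXY n m
  · exact (hXY m n).swap
  · exact ⟨_, Submodule.smul_mem _ _ (hierarchy_mem_symSpan_master _),
      (schField_hierarchy _ _ _).smul _, varBracket_masters n m⟩

/-- Linearity is used in the second slot only; antisymmetry exchanges the slots. -/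
lemma bracketInSpan_span {p q : NormalField γ₀ × VarOperator γ₀}
    (hp : p ∈ Submodule.span ℝ (generators γ₀)) (hq : q ∈ Submodule.span ℝ (generators γ₀)) :
    BracketInSpan p q :=
  bracketInSpan_of_mem_span (generators_subset hp) hq fun _ hr =>
    (bracketInSpan_of_mem_span (generators_subset (Submodule.subset_span hr)) hp
      fun _ ht => bracketInSpan_generators hr ht).swap

lemma exists_isCommutator {U V : NormalField γ₀} (hU : U ∈ symSpan γ₀) (hV : V ∈ symSpan γ₀) :
    ∃ W ∈ symSpan γ₀, IsCommutator U V W := by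
  rw [symSpan_eq] at hU hV
  obtain ⟨p, hp, rfl⟩ := hU
  obtain ⟨q, hq, rfl⟩ := hV
  obtain ⟨W, hW, -, h⟩ := bracketInSpan_span hp hq
  exact ⟨W, hW, isCommutator_of_varBracket (generators_subset hp) (generators_subset hq) h⟩

/-! ### Membership and commutators of the X_n and Y_n -/

lemma symX_mem (n : ℕ) : symX γ₀ n ∈ vectorFields γ₀ := by
  rw [symX_eq]; exact hierarchy_mem 0 1 n

lemma masterY_mem (n : ℕ) : masterY γ₀ n ∈ vectorFields γ₀ := by
  rw [masterY_eq]; exact hierarchy_mem 1 0 (n - 1)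

lemma isCommutator_symX_symX (n m : ℕ) : IsCommutator (symX γ₀ n) (symX γ₀ m) 0 := by
  rw [symX_eq, symX_eq]
  exact isCommutator_of_varBracket (hierarchyPair_mem 0 1 n) (hierarchyPair_mem 0 1 m)
    (varBracket_symmetries n m)

lemma isCommutator_symX_smul_symX (n m : ℕ) (a : ℝ) :
    IsCommutator (symX γ₀ n) (a • symX γ₀ m) 0 := by
  rw [symX_eq, symX_eq]
  refine isCommutator_of_varBracket (q := a • hierarchyPair γ₀ 0 1 m) (hierarchyPair_mem 0 1 n)
    (Submodule.smul_mem _ a (hierarchyPair_mem 0 1 m)) fun γ => ?_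
  rw [varBracket_smul a (hierarchyPair_mem 0 1 n) (hierarchyPair_mem 0 1 m),
    varBracket_symmetries, lift_zero, smul_zero]

lemma isCommutator_symX_masterY (n : ℕ) {m : ℕ} (hm : 1 ≤ m) :
    IsCommutator (symX γ₀ n) (masterY γ₀ m) (((n : ℝ) + 2) • symX γ₀ (n + m)) := by
  obtain ⟨m, rfl⟩ := Nat.exists_eq_add_of_le' hm
  rw [symX_eq, symX_eq, masterY_eq]
  exact isCommutator_of_varBracket (hierarchyPair_mem 0 1 n) (hierarchyPair_mem 1 0 m)
    (varBracket_symmetry_master n m)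

lemma isCommutator_masterY_masterY {n m : ℕ} (hn : 1 ≤ n) (hm : 1 ≤ m) :
    IsCommutator (masterY γ₀ n) (masterY γ₀ m) (((n : ℝ) - (m : ℝ)) • masterY γ₀ (n + m)) := by
  obtain ⟨n, rfl⟩ := Nat.exists_eq_add_of_le' hn
  obtain ⟨m, rfl⟩ := Nat.exists_eq_add_of_le' hm
  rw [masterY_eq, masterY_eq, masterY_eq]
  refine isCommutator_of_varBracket (hierarchyPair_mem 1 0 n) (hierarchyPair_mem 1 0 m) fun γ => ?_
  rw [varBracket_masters, show n + 1 + (m + 1) - 1 = n + m + 1 by lia]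
  push_cast
  rw [show (n : ℝ) + 1 - (m + 1) = n - m by ring]

end

end VortexFilament

end

theorem proposition9 (γ₀ : ℝ → E3) (hγ₀ : IsReferenceCurve γ₀) :
    (∀ n, symX γ₀ n ∈ vectorFields γ₀) ∧
    (∀ n, 1 ≤ n → masterY γ₀ n ∈ vectorFields γ₀) ∧
    (∀ n m, IsCommutator (symX γ₀ n) (symX γ₀ m) 0) ∧
    (∀ n m, 1 ≤ m →
      IsCommutator (symX γ₀ n) (masterY γ₀ m) (((n : ℝ) + 2) • symX γ₀ (n + m))) ∧
    (∀ n m, 1 ≤ n → 1 ≤ m →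
      IsCommutator (masterY γ₀ n) (masterY γ₀ m) (((n : ℝ) - (m : ℝ)) • masterY γ₀ (n + m))) ∧
    (symSpan γ₀ ≤ vectorFields γ₀ ∧
      ∀ U ∈ symSpan γ₀, ∀ V ∈ symSpan γ₀, ∃ W ∈ symSpan γ₀, IsCommutator U V W) ∧
    (lift (symX γ₀ 0) = fun γ s => kappa γ s • fieldB γ s) ∧
    (∀ n, IsSymmetry (symX γ₀ 0) (symX γ₀ n)) ∧
    (∀ n, 1 ≤ n → IsMasterSymmetry (symX γ₀ 0) (masterY γ₀ n)) := by
  refine ⟨symX_mem, fun n _ => masterY_mem n, isCommutator_symX_symX,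
    fun n m hm => isCommutator_symX_masterY n hm,
    fun n m hn hm => isCommutator_masterY_masterY hn hm,
    ⟨Submodule.span_le.mpr ?_, fun U hU V hV => exists_isCommutator hU hV⟩, ?_,
    fun n => ⟨symX_mem n, isCommutator_symX_symX 0 n⟩,
    -- The bracket with X_0 is (0 + 2)X_{0+n}, a multiple of a symmetry and hence a symmetry.
    fun n hn => ⟨masterY_mem n, _, isCommutator_symX_masterY 0 hn,
      Submodule.smul_mem _ _ (symX_mem _), isCommutator_symX_smul_symX _ _ _⟩⟩
  · rintro _ (⟨n, rfl⟩ | ⟨n, -, rfl⟩)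
    exacts [symX_mem n, masterY_mem n]
  · ext1 γ
    rw [symX_eq, lift_hierarchy_zero]
    ext1 s
    simp [kappa, fieldB]
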